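/- Let $d\ge 3$ and $T\ge 1$ be integers and let $\Theta=\{x\in\mathbb R^d:\|x\|_2\le 1\}$, $V(x)=\tfrac12\|x\|_2^2$. Let $f_1,f_2,\dots:\mathbb R^d\to\mathbb R$ be fixed convex functions such that $|f_t(x)-f_t(x')|\le L\|x-x'\|_2$ for all $x,x'\in\mathbb R^d$ and all $t\ge 1$, where $L>0$. Let $\zeta_1,\zeta_2,\dots$ be independent random vectors, each uniformly distributed (normalized surface measure) on the $\ell_1$-sphere $\{x\in\mathbb R^d:\|x\|_1=1\}$, and let the noises $\xi'_t,\xi''_t$ be canceling: $\xi'_t=\xi''_t$ almost surely for every $t$. Consider the algorithm which starts from $z_1=0$ and for $t=1,2,\dots$ sets $$x_t=\operatorname*{arg\,max}_{x\in\Theta}\{\eta\langle z_t,x\rangle-V(x)\},\quad y'_t=f_t(x_t+h\zeta_t)+\xi'_t,\quad y''_t=f_t(x_t-h\zeta_t)+\xi''_t,$$ $$g_t=\frac{d}{2h}(y'_t-y''_t)\operatorname{sign}(\zeta_t),\qquad z_{t+1}=z_t-g_t,$$ where $\operatorname{sign}$ acts coordinatewise, with $\operatorname{sign}(0)=1$.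 Let $R\in[1/\sqrt2,1]$ (so that $R^2\ge\sup_\Theta V-\inf_\Theta V=\tfrac12$), and let the parameters be $$\eta=\frac{R}{(\sqrt6+\sqrt{12})\,L\,\sqrt{dT}},\qquad 0<h\le\frac{7R\sqrt d}{100\,\mathrm b_2(d)\sqrt T},$$ where $\mathrm b_2(d)=\frac{2\sqrt d}{d+1}$ if $2<\log d$ and $\mathrm b_2(d)=\frac{e\log d}{d+1}$ otherwise. Then for every $x\in\Theta$ the random variable $\sum_{t=1}^T(f_t(x_t)-f_t(x))$ is integrable and $$\mathbb E\Big[\sum_{t=1}^T\big(f_t(x_t)-f_t(x)\big)\Big]\le 11.9\,L\sqrt{dT}.$$ -/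

import Mathlib

open MeasureTheory ProbabilityTheory

open scoped MeasureTheory

/-- The unit sphere of the `ℓ₁`-norm in `ℝ^d`. -/
def l1Sphere (d : ℕ) : Set (EuclideanSpace ℝ (Fin d)) :=
  {x | ∑ i, |x i| = 1}

/-- `ζ` is uniformly distributed on the `ℓ₁`-sphere of `ℝ^d`: its law is the normalized surface
measure, i.e. the `(d-1)`-dimensional Hausdorff measure (for the Euclidean distance) restricted to
the sphere and divided by its total mass. -/
def IsUniformOnL1Sphere {Ω : Type*} [MeasurableSpace Ω] (P : Measure Ω) {d : ℕ}
    (ζ : Ω → EuclideanSpace ℝ (Fin d)) : Prop :=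
  pdf.IsUniform ζ (l1Sphere d) P
    (μH[(d : ℝ) - 1] : Measure (EuclideanSpace ℝ (Fin d)))

/-- The vector of the signs of the coordinates, with the sign of `0` equal to `1`. -/
noncomputable def signVec {d : ℕ} (v : EuclideanSpace ℝ (Fin d)) : EuclideanSpace ℝ (Fin d) :=
  WithLp.toLp 2 (fun i => if 0 ≤ v i then 1 else -1)

/-- The two-point `ℓ₁`-randomized gradient estimate `(d / 2h) (y' - y'') sign ζ`. -/
noncomputable def l1GradientEstimate {d : ℕ} (h y' y'' : ℝ) (ζ : EuclideanSpace ℝ (Fin d)) :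
    EuclideanSpace ℝ (Fin d) :=
  ((d : ℝ) / (2 * h) * (y' - y'')) • signVec ζ

/-- One run of zero-order `ℓ₁`-randomized online dual averaging on `Θ` with the function `V`,
losses `f`, step sizes `η`, discretization parameters `h`, noises `ξ'`, `ξ''` and random directions
`ζ`. The actions are `x`, the dual variables are `z`. Rounds are numbered from `0`, so that
the index `t` stands for round `t + 1`. -/
structure IsL1DualAveragingRun {d : ℕ} (Θ : Set (EuclideanSpace ℝ (Fin d)))
    (V : EuclideanSpace ℝ (Fin d) → ℝ) (f : ℕ → EuclideanSpace ℝ (Fin d) → ℝ)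
    (η h ξ' ξ'' : ℕ → ℝ) (ζ x z : ℕ → EuclideanSpace ℝ (Fin d)) : Prop where
  /-- Initialization. -/
  z_zero : z 0 = 0
  /-- `x t` is a point of `Θ` ... -/
  x_mem : ∀ t, x t ∈ Θ
  /-- ... at which `u ↦ η t ⟨z t, u⟩ - V u` is maximal over `Θ`. -/
  x_argmax : ∀ t, IsMaxOn (fun u => η t * inner ℝ (z t) u - V u) Θ (x t)
  /-- The two queries at `x t ± h t • ζ t` and the update of the dual variable. -/
  z_succ : ∀ t, z (t + 1) = z t -
    l1GradientEstimate (h t) (f t (x t + h t • ζ t) + ξ' t) (f t (x t - h t • ζ t) + ξ'' t) (ζ t)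

/-- The sequence `b_q(d)`. -/
noncomputable def bSeq (q : ℝ) (d : ℕ) : ℝ :=
  1 / ((d : ℝ) + 1) *
    if q < Real.log d then q * (d : ℝ) ^ (1 / q) else Real.exp 1 * Real.log d

/-- The step size for canceling noise (finite exponents `p`, `q`). -/
noncomputable def cancelingStepSize (p q R L : ℝ) (d T : ℕ) : ℝ :=
  (√6 + √12)⁻¹ * R / L * √((d : ℝ) ^ (-1 - 2 / min q 2 + 2 / p) / T)

/-- The largest discretization parameter allowed for canceling noise (finite exponents). -/
noncomputable def cancelingMaxDiscretization (p q R : ℝ) (d T : ℕ) : ℝ :=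
  7 * R / (100 * bSeq q d * √(T : ℝ)) * (d : ℝ) ^ (1 / 2 + 1 / min q 2 - 1 / p)

/-! Canceling noise disappears from `y' - y''`, so almost surely the run is dual averaging driven by
`l1Gradient`. For the Euclidean regularizer on the unit ball, dual averaging has regret against the
linear losses `g t` of at most `1 / (2η) + (η / 2) ∑ ‖g t‖²` (`dualAveraging_regret_le`). It remains
to bound the bias and the second moment of the estimate.

Bias. Let `f_h` be the average of `f (· + h u)` over `u` in the `ℓ₁`-ball. By the divergence theorem
for the `ℓ₁`-ball, whose normals are the sign vectors, the spherical mean of `(d / h) f (x + h θ)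
sign θ` is the gradient of `f_h` at `x`. Convexity of `f` therefore bounds `f_h x - f_h u` by the
mean of `⟨g, x - u⟩`. Replacing `f_h` by `f` costs `L h √(2 / (d + 1))` at each of the two points
(`sub_le_integral_inner_l1Gradient`). The divergence formula is proved by translating the ball and
not by differentiating `f` (`tendsto_inv_mul_integral_l1BallIndicator_sub`).

Second moment. Up to a factor, `‖g‖²` is `d³ L² F(ζ)²` with `F` odd and `1`-Lipschitz, and the claim
is that `F²` has mean at most `72 / d²` (`integral_sq_le_of_odd_of_lipschitzWith`). If `X` has
independent Laplace coordinates, then `X / ‖X‖₁` is uniform on the sphere and independent of `‖X‖₁`.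
Let `H x = ‖x‖₁ F(x / ‖x‖₁)`. Then `H X` has mean zero and second moment `d (d + 1) E F²`, and the
squared gradient of `H` has mean at most `18`. The Poincaré inequality with constant `4` for product
Laplace measures (`variance_pi_laplaceMeasure_le`) gives `72 = 4 · 18`.

Uniformity is stated through Hausdorff measure. It is turned into polar coordinates by showing that
the cone measure of the `ℓ₁`-sphere is a multiple of Hausdorff measure
(`exists_l1ConeMeasure_eq_mul_hausdorffMeasure`). -/

/-! ### The Laplace distribution and its Poincaré inequality on the line. -/

/-- The standard Laplace distribution on `ℝ`. -/
noncomputable def laplaceMeasure : Measure ℝ :=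
  volume.withDensity fun x => ENNReal.ofReal (Real.exp (-|x|) / 2)

theorem integrable_of_integrableOn_Ioi_comp_neg {φ : ℝ → ℝ}
    (h₁ : IntegrableOn φ (Set.Ioi 0)) (h₂ : IntegrableOn (fun x => φ (-x)) (Set.Ioi 0)) :
    Integrable φ := by
  rw [← integrableOn_univ, ← Set.Iio_union_Ici (a := (0 : ℝ))]
  refine IntegrableOn.union ?_ ((integrableOn_Ici_iff_integrableOn_Ioi (by simp)).2 h₁)
  have h := (Measure.measurePreserving_neg (volume : Measure ℝ)).integrableOn_comp_preimage
    (Homeomorph.neg ℝ).measurableEmbedding (f := fun x => φ (-x)) (s := Set.Ioi 0)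
  simpa [Function.comp_def] using h.2 h₂

theorem integral_eq_integral_Ioi_add_comp_neg {φ : ℝ → ℝ} (h : Integrable φ) :
    ∫ x, φ x = (∫ x in Set.Ioi 0, φ x) + ∫ x in Set.Ioi 0, φ (-x) := by
  rw [integral_comp_neg_Ioi, neg_zero, add_comm,
    intervalIntegral.integral_Iic_add_Ioi h.integrableOn h.integrableOn]

theorem integrable_abs_pow_mul_exp_neg_abs (n : ℕ) :
    Integrable fun x : ℝ => |x| ^ n * Real.exp (-|x|) := by
  have h : IntegrableOn (fun x : ℝ => |x| ^ n * Real.exp (-|x|)) (Set.Ioi 0) := by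
    refine (Real.GammaIntegral_convergent (s := n + 1) (by positivity)).congr_fun
      (fun x hx => ?_) measurableSet_Ioi
    have hx : 0 < x := hx
    simp [abs_of_pos hx, mul_comm]
  exact integrable_of_integrableOn_Ioi_comp_neg h (by simpa using h)

theorem integral_abs_pow_mul_exp_neg_abs (n : ℕ) :
    ∫ x : ℝ, |x| ^ n * Real.exp (-|x|) = 2 * n.factorial := by
  rw [integral_comp_abs (f := fun x => x ^ n * Real.exp (-x)), ← Real.Gamma_nat_eq_factorial,
    Real.Gamma_eq_integral (by positivity)]
  congr 1
  refine setIntegral_congr_fun measurableSet_Ioi fun x _ => ?_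
  simp [mul_comm]

theorem integral_laplaceMeasure (φ : ℝ → ℝ) :
    ∫ x, φ x ∂laplaceMeasure = ∫ x, Real.exp (-|x|) / 2 * φ x := by
  rw [laplaceMeasure, integral_withDensity_eq_integral_toReal_smul (by fun_prop) (by simp)]
  refine integral_congr_ae (.of_forall fun x => ?_)
  simp [ENNReal.toReal_ofReal (show 0 ≤ Real.exp (-|x|) / 2 by positivity)]

theorem integrable_laplaceMeasure_iff (φ : ℝ → ℝ) :
    Integrable φ laplaceMeasure ↔ Integrable fun x => Real.exp (-|x|) / 2 * φ x := by
  rw [laplaceMeasure, integrable_withDensity_iff (by fun_prop) (by simp)]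
  refine integrable_congr (.of_forall fun x => ?_)
  simp [ENNReal.toReal_ofReal (show 0 ≤ Real.exp (-|x|) / 2 by positivity), mul_comm]

theorem integrable_abs_pow_laplaceMeasure (n : ℕ) :
    Integrable (fun x => |x| ^ n) laplaceMeasure := by
  rw [integrable_laplaceMeasure_iff]
  refine ((integrable_abs_pow_mul_exp_neg_abs n).const_mul (1 / 2)).congr (.of_forall fun x => ?_)
  ring

theorem integral_abs_pow_laplaceMeasure (n : ℕ) :
    ∫ x, |x| ^ n ∂laplaceMeasure = n.factorial := by
  have h : ∀ x : ℝ, Real.exp (-|x|) / 2 * |x| ^ n = 1 / 2 * (|x| ^ n * Real.exp (-|x|)) :=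
    fun x => by ring
  simp only [integral_laplaceMeasure, h, integral_const_mul, integral_abs_pow_mul_exp_neg_abs]
  ring

instance : IsProbabilityMeasure laplaceMeasure := by
  have h := integral_abs_pow_laplaceMeasure 0
  simp only [pow_zero, integral_const, smul_eq_mul, mul_one, Nat.factorial_zero,
    Nat.cast_one] at h
  exact ⟨by rw [← ENNReal.toReal_eq_one_iff]; exact h⟩

theorem memLp_two_id_laplaceMeasure : MemLp (fun x : ℝ => x) 2 laplaceMeasure := by
  rw [memLp_two_iff_integrable_sq (by fun_prop)]
  simpa using integrable_abs_pow_laplaceMeasure 2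

theorem LipschitzWith.memLp_two_laplaceMeasure {K : NNReal} {g : ℝ → ℝ} (hg : LipschitzWith K g) :
    MemLp g 2 laplaceMeasure := by
  refine (((memLp_two_id_laplaceMeasure.norm.const_mul (K : ℝ)).add
    (memLp_const |g 0|))).mono hg.continuous.aestronglyMeasurable (.of_forall fun x => ?_)
  have h := hg.dist_le_mul x 0
  rw [Real.dist_eq, dist_zero_right] at h
  have h2 : |g x| ≤ |g x - g 0| + |g 0| := by
    simpa using abs_add_le (g x - g 0) (g 0)
  simp only [Real.norm_eq_abs, Pi.add_apply] at h ⊢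
  exact (h2.trans (by linarith)).trans (le_abs_self _)

theorem LipschitzWith.abs_deriv_le {K : NNReal} {g : ℝ → ℝ} (hg : LipschitzWith K g) (x : ℝ) :
    |deriv g x| ≤ K := by
  simpa using norm_deriv_le_of_lipschitz hg

theorem LipschitzWith.integrable_deriv_sq_laplaceMeasure {K : NNReal} {g : ℝ → ℝ}
    (hg : LipschitzWith K g) : Integrable (fun x => deriv g x ^ 2) laplaceMeasure := by
  refine .of_bound ((measurable_deriv g).pow_const 2).aestronglyMeasurable ((K : ℝ) ^ 2)
    (.of_forall fun x => ?_)
  rw [norm_pow, Real.norm_eq_abs]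
  gcongr
  exact hg.abs_deriv_le x

/-- Integrating `(g² e^{-x})'` over `[0, N]` leaves the nonnegative boundary term `g(N)² e^{-N}`, so
`∫ g² e^{-x} ≤ ∫ 2 g g' e^{-x}`. Then `2 g g' ≤ g² / 2 + 2 g'²` yields the constant `4`. -/
theorem LipschitzWith.integral_sq_mul_exp_neg_le {K : NNReal} {g : ℝ → ℝ}
    (hg : LipschitzWith K g) (h0 : g 0 = 0) {N : ℝ} (hN : 0 ≤ N) :
    ∫ x in 0..N, g x ^ 2 * Real.exp (-x) ≤ 4 * ∫ x in 0..N, deriv g x ^ 2 * Real.exp (-x) := by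
  have hga : AbsolutelyContinuousOnInterval g 0 N :=
    (hg.lipschitzOnWith (s := Set.uIcc 0 N)).absolutelyContinuousOnInterval
  have hea : AbsolutelyContinuousOnInterval (fun x => Real.exp (-x)) 0 N := by
    have : ContDiffOn ℝ 1 (fun x => Real.exp (-x)) (Set.uIcc 0 N) := by
      apply ContDiff.contDiffOn; fun_prop
    obtain ⟨C, hC⟩ := this.exists_lipschitzOnWith (by simp) (convex_uIcc 0 N) isCompact_uIcc
    exact hC.absolutelyContinuousOnInterval
  have hprod := (hga.fun_mul hga).integral_deriv_mul_eq_sub hea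
  have hd : ∀ᵐ x, x ∈ Set.uIoc 0 N → deriv (fun x => g x * g x) x * Real.exp (-x) +
      g x * g x * deriv (fun x => Real.exp (-x)) x
        = (2 * g x * deriv g x - g x ^ 2) * Real.exp (-x) := by
    filter_upwards [hg.ae_differentiableAt] with x hx _
    have h1 : deriv (fun x => Real.exp (-x)) x = -Real.exp (-x) := by
      simpa using (hasDerivAt_neg x).exp.deriv
    rw [h1, deriv_fun_mul hx hx]
    ring
  rw [intervalIntegral.integral_congr_ae hd] at hprod
  have hcont := hg.continuous
  have hD : IntervalIntegrable (deriv g) volume 0 N := hga.intervalIntegrable_deriv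
  have i1 : IntervalIntegrable (fun x => g x ^ 2 * Real.exp (-x)) volume 0 N :=
    Continuous.intervalIntegrable (by fun_prop) _ _
  have i2 : IntervalIntegrable (fun x => deriv g x ^ 2 * Real.exp (-x)) volume 0 N := by
    rw [intervalIntegrable_iff]
    refine .of_bound (by simp) (by fun_prop) ((K : ℝ) ^ 2) ?_
    filter_upwards [ae_restrict_mem measurableSet_uIoc] with x hx
    rw [Set.uIoc_of_le hN] at hx
    rw [norm_mul, norm_pow, Real.norm_eq_abs, Real.norm_eq_abs, Real.abs_exp]
    have : Real.exp (-x) ≤ 1 := Real.exp_le_one_iff.2 (by linarith [hx.1])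
    nlinarith [hg.abs_deriv_le x, abs_nonneg (deriv g x), Real.exp_pos (-x),
      pow_le_pow_left₀ (abs_nonneg _) (hg.abs_deriv_le x) 2, sq_nonneg |deriv g x|]
  have i3 : IntervalIntegrable (fun x => (2 * g x * deriv g x - g x ^ 2) * Real.exp (-x))
      volume 0 N := by
    have := (hD.continuousOn_mul (g := fun x => 2 * g x * Real.exp (-x))
      (by fun_prop)).sub i1
    refine this.congr fun x _ => ?_
    ring
  have hnn : 0 ≤ ∫ x in 0..N, (2 * g x * deriv g x - g x ^ 2) * Real.exp (-x) := by
    rw [hprod, h0]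
    have := mul_nonneg (mul_self_nonneg (g N)) (Real.exp_pos (-N)).le
    simpa using this
  have hle : ∫ x in 0..N, (2 * g x * deriv g x - g x ^ 2) * Real.exp (-x) ≤
      ∫ x in 0..N, (2 * (deriv g x ^ 2 * Real.exp (-x)) - 1 / 2 * (g x ^ 2 * Real.exp (-x))) := by
    refine intervalIntegral.integral_mono_on hN i3 ((i2.const_mul 2).sub (i1.const_mul _))
      fun x _ => ?_
    nlinarith [mul_nonneg (sq_nonneg (g x - 2 * deriv g x)) (Real.exp_pos (-x)).le]
  rw [intervalIntegral.integral_sub (i2.const_mul 2) (i1.const_mul _),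
    intervalIntegral.integral_const_mul, intervalIntegral.integral_const_mul] at hle
  linarith

theorem LipschitzWith.variance_laplaceMeasure_le {K : NNReal} {g : ℝ → ℝ}
    (hg : LipschitzWith K g) :
    Var[g; laplaceMeasure] ≤ 4 * ∫ x, deriv g x ^ 2 ∂laplaceMeasure := by
  -- A shift changes neither side. Once `g 0 = 0`, the variance is bounded by the second moment,
  -- which splits over the two half-lines; the negative one is handled by reflection.
  wlog h0 : g 0 = 0 generalizing g
  · have hg' : LipschitzWith K fun x => g x - g 0 := by
      simpa using hg.sub (LipschitzWith.const (g 0))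
    have h := this hg' (by simp)
    rw [variance_sub_const hg.continuous.aestronglyMeasurable] at h
    simpa using h
  refine (variance_le_expectation_sq hg.continuous.aestronglyMeasurable).trans ?_
  have I1 : Integrable fun x => Real.exp (-|x|) / 2 * g x ^ 2 :=
    (integrable_laplaceMeasure_iff _).1 hg.memLp_two_laplaceMeasure.integrable_sq
  have I2 : Integrable fun x => Real.exp (-|x|) / 2 * deriv g x ^ 2 :=
    (integrable_laplaceMeasure_iff _).1 hg.integrable_deriv_sq_laplaceMeasure
  have half : ∀ k : ℝ → ℝ, LipschitzWith K k → k 0 = 0 →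
      ∫ x in Set.Ioi 0, Real.exp (-|x|) / 2 * k x ^ 2 ≤
        4 * ∫ x in Set.Ioi 0, Real.exp (-|x|) / 2 * deriv k x ^ 2 := by
    intro k hk hk0
    have J1 : Integrable fun x => Real.exp (-|x|) / 2 * k x ^ 2 :=
      (integrable_laplaceMeasure_iff _).1 hk.memLp_two_laplaceMeasure.integrable_sq
    have J2 : Integrable fun x => Real.exp (-|x|) / 2 * deriv k x ^ 2 :=
      (integrable_laplaceMeasure_iff _).1 hk.integrable_deriv_sq_laplaceMeasure
    refine le_of_tendsto_of_tendsto
      (intervalIntegral_tendsto_integral_Ioi 0 J1.integrableOn Filter.tendsto_id)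
      ((intervalIntegral_tendsto_integral_Ioi 0 J2.integrableOn Filter.tendsto_id).const_mul 4) ?_
    filter_upwards [Filter.eventually_ge_atTop (0 : ℝ)] with N hN
    have key := hk.integral_sq_mul_exp_neg_le hk0 hN
    have e : ∀ φ : ℝ → ℝ, ∫ x in 0..N, Real.exp (-|x|) / 2 * φ x ^ 2
        = 1 / 2 * ∫ x in 0..N, φ x ^ 2 * Real.exp (-x) := by
      intro φ
      rw [← intervalIntegral.integral_const_mul]
      refine intervalIntegral.integral_congr fun x hx => ?_
      rw [Set.uIcc_of_le hN] at hx
      simp only [abs_of_nonneg hx.1]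
      ring
    simp only [id, e]
    linarith
  have hneg : LipschitzWith K fun x => g (-x) := by
    simpa [Function.comp_def] using hg.comp (LipschitzWith.id.neg)
  have h1 := half g hg h0
  have h2 := half _ hneg (by simpa using h0)
  simp only [integral_laplaceMeasure]
  change ∫ x, Real.exp (-|x|) / 2 * g x ^ 2 ≤ _
  rw [integral_eq_integral_Ioi_add_comp_neg I1, integral_eq_integral_Ioi_add_comp_neg I2]
  simp only [deriv_comp_neg, neg_sq] at h2
  simp only [abs_neg]
  linarith

/-! ### Tensorization of the Poincaré inequality. -/

theorem sq_integral_le_integral_sq {α : Type*} [MeasurableSpace α] {μ : Measure α}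
    [IsProbabilityMeasure μ] {X : α → ℝ} (hX : MemLp X 2 μ) :
    (∫ a, X a ∂μ) ^ 2 ≤ ∫ a, X a ^ 2 ∂μ := by
  have h := variance_nonneg X μ
  rw [variance_eq_sub hX] at h
  simpa using h

theorem MeasureTheory.MemLp.integral_prod_left_two {α β : Type*} [MeasurableSpace α]
    [MeasurableSpace β]
    {μ : Measure α} {ν : Measure β} [IsProbabilityMeasure μ] [IsProbabilityMeasure ν]
    {H : α × β → ℝ} (hH : MemLp H 2 (μ.prod ν)) (hs : ∀ x, MemLp (fun y => H (x, y)) 2 ν) :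
    MemLp (fun x => ∫ y, H (x, y) ∂ν) 2 μ := by
  have hm : AEStronglyMeasurable (fun x => ∫ y, H (x, y) ∂ν) μ :=
    hH.aestronglyMeasurable.integral_prod_right'
  rw [memLp_two_iff_integrable_sq hm]
  refine hH.integrable_sq.integral_prod_left.mono' (hm.pow 2) (.of_forall fun x => ?_)
  rw [Real.norm_of_nonneg (sq_nonneg _)]
  exact sq_integral_le_integral_sq (hs x)

/-- The Efron-Stein inequality for two independent coordinates. -/
theorem variance_prod_le {α β : Type*} [MeasurableSpace α] [MeasurableSpace β]
    {μ : Measure α} {ν : Measure β} [IsProbabilityMeasure μ] [IsProbabilityMeasure ν]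
    {H : α × β → ℝ} (hH : MemLp H 2 (μ.prod ν)) (hs₁ : ∀ y, MemLp (fun x => H (x, y)) 2 μ)
    (hs₂ : ∀ x, MemLp (fun y => H (x, y)) 2 ν) :
    Var[H; μ.prod ν] ≤
      (∫ y, Var[fun x => H (x, y); μ] ∂ν) + ∫ x, Var[fun y => H (x, y); ν] ∂μ := by
  set a : α → ℝ := fun x => ∫ y, H (x, y) ∂ν with ha
  set b : β → ℝ := fun y => ∫ x, H (x, y) ∂μ with hb
  set m : ℝ := ∫ p, H p ∂(μ.prod ν) with hm
  have hHi : Integrable H (μ.prod ν) := hH.integrable (by norm_num)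
  have ha2 : MemLp a 2 μ := hH.integral_prod_left_two hs₂
  have hswap : MemLp (fun q : β × α => H q.swap) 2 (ν.prod μ) :=
    hH.comp_measurePreserving Measure.measurePreserving_swap
  have hb2 : MemLp b 2 ν := hswap.integral_prod_left_two (H := fun q : β × α => H q.swap) hs₁
  have ha' : MemLp (fun p : α × β => a p.1) 2 (μ.prod ν) :=
    ha2.comp_measurePreserving measurePreserving_fst
  have hb' : MemLp (fun p : α × β => b p.2) 2 (μ.prod ν) :=
    hb2.comp_measurePreserving measurePreserving_snd
  have ma : ∫ x, a x ∂μ = m := (integral_prod H hHi).symm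
  have mb : ∫ y, b y ∂ν = m := (integral_prod_symm H hHi).symm
  have e1 : ∫ p, a p.1 ^ 2 ∂(μ.prod ν) = ∫ x, a x ^ 2 ∂μ := by
    simpa using integral_fun_fst (μ := μ) (ν := ν) (fun x => a x ^ 2)
  have e2 : ∫ p, b p.2 ^ 2 ∂(μ.prod ν) = ∫ y, b y ^ 2 ∂ν := by
    simpa using integral_fun_snd (μ := μ) (ν := ν) (fun x => b x ^ 2)
  have iHa : Integrable (fun p => H p * a p.1) (μ.prod ν) := hH.integrable_mul ha'
  have iHb : Integrable (fun p => H p * b p.2) (μ.prod ν) := hH.integrable_mul hb'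
  have iab : Integrable (fun p => a p.1 * b p.2) (μ.prod ν) := ha'.integrable_mul hb'
  have e3 : ∫ p, H p * a p.1 ∂(μ.prod ν) = ∫ x, a x ^ 2 ∂μ := by
    rw [integral_prod _ iHa]
    refine integral_congr_ae (.of_forall fun x => ?_)
    simp only [integral_mul_const]
    ring
  have e4 : ∫ p, H p * b p.2 ∂(μ.prod ν) = ∫ y, b y ^ 2 ∂ν := by
    rw [integral_prod_symm _ iHb]
    refine integral_congr_ae (.of_forall fun x => ?_)
    simp only [integral_mul_const]
    ring
  have e5 : ∫ p, a p.1 * b p.2 ∂(μ.prod ν) = m ^ 2 := by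
    rw [integral_prod_mul, ma, mb, sq]
  have e6 : ∫ p, a p.1 ∂(μ.prod ν) = m := by
    rw [← ma]; simpa using integral_fun_fst (μ := μ) (ν := ν) a
  have e7 : ∫ p, b p.2 ∂(μ.prod ν) = m := by
    rw [← mb]; simpa using integral_fun_snd (μ := μ) (ν := ν) b
  have iA := ha'.integrable (q := 2) (by norm_num)
  have iB := hb'.integrable (q := 2) (by norm_num)
  -- `H - a - b + m` is the pure interaction part of `H`. Its second moment is `E H² - E a² - E b² +
  -- m²`, and the nonnegativity of this number is exactly the claim.
  have key : 0 ≤ ∫ p, (H p - a p.1 - b p.2 + m) ^ 2 ∂(μ.prod ν) :=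
    integral_nonneg fun p => sq_nonneg _
  have expand : ∀ p : α × β, (H p - a p.1 - b p.2 + m) ^ 2 =
      H p ^ 2 + a p.1 ^ 2 + b p.2 ^ 2 + m ^ 2 + -2 * (H p * a p.1) + -2 * (H p * b p.2)
        + 2 * m * H p + 2 * (a p.1 * b p.2) + -2 * m * a p.1 + -2 * m * b p.2 := fun p => by ring
  simp only [expand] at key
  have j1 := hH.integrable_sq
  have j2 := j1.fun_add ha'.integrable_sq
  have j3 := j2.fun_add hb'.integrable_sq
  have j4 := j3.fun_add (integrable_const (μ := μ.prod ν) (m ^ 2))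
  have j5 := j4.fun_add (iHa.const_mul (-2))
  have j6 := j5.fun_add (iHb.const_mul (-2))
  have j7 := j6.fun_add (hHi.const_mul (2 * m))
  have j8 := j7.fun_add (iab.const_mul 2)
  have j9 := j8.fun_add (iA.const_mul (-2 * m))
  rw [integral_add j9 (iB.const_mul (-2 * m)), integral_add j8 (iA.const_mul (-2 * m)),
    integral_add j7 (iab.const_mul 2), integral_add j6 (hHi.const_mul (2 * m)),
    integral_add j5 (iHb.const_mul (-2)), integral_add j4 (iHa.const_mul (-2)),
    integral_add j3 (integrable_const _), integral_add j2 hb'.integrable_sq,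
    integral_add j1 ha'.integrable_sq] at key
  simp only [integral_const_mul, integral_const, probReal_univ, one_smul,
    e1, e2, e3, e4, e5, e6, e7, ← hm] at key
  have v1 : ∫ y, Var[fun x => H (x, y); μ] ∂ν = ∫ p, H p ^ 2 ∂(μ.prod ν) - ∫ y, b y ^ 2 ∂ν := by
    rw [integral_prod_symm _ j1, ← integral_sub j1.integral_prod_right hb2.integrable_sq]
    exact integral_congr_ae (.of_forall fun y => variance_eq_sub (hs₁ y))
  have v2 : ∫ x, Var[fun y => H (x, y); ν] ∂μ = ∫ p, H p ^ 2 ∂(μ.prod ν) - ∫ x, a x ^ 2 ∂μ := by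
    rw [integral_prod _ j1, ← integral_sub j1.integral_prod_left ha2.integrable_sq]
    exact integral_congr_ae (.of_forall fun y => variance_eq_sub (hs₂ y))
  rw [v1, v2, variance_eq_sub hH, ← hm]
  simp only [Pi.pow_apply]
  linarith

theorem LipschitzWith.memLp_two_pi_laplaceMeasure {n : ℕ} {K : NNReal} {H : (Fin n → ℝ) → ℝ}
    (hH : LipschitzWith K H) : MemLp H 2 (Measure.pi fun _ => laplaceMeasure) := by
  have hc : ∀ i : Fin n, MemLp (fun x : Fin n → ℝ => x i) 2
      (Measure.pi fun _ => laplaceMeasure) := fun i =>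
    memLp_two_id_laplaceMeasure.comp_measurePreserving
      (measurePreserving_eval (fun _ : Fin n => laplaceMeasure) i)
  have hs : MemLp (fun x : Fin n → ℝ => ∑ i, |x i|) 2 (Measure.pi fun _ => laplaceMeasure) :=
    memLp_finsetSum _ fun i _ => (hc i).norm
  refine ((hs.const_mul (K : ℝ)).add (memLp_const |H 0|)).mono
    hH.continuous.aestronglyMeasurable (.of_forall fun x => ?_)
  have h := hH.dist_le_mul x 0
  rw [Real.dist_eq, dist_zero_right] at h
  have h2 : |H x| ≤ |H x - H 0| + |H 0| := by
    simpa using abs_add_le (H x - H 0) (H 0)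
  have h3 : ‖x‖ ≤ ∑ i, |x i| := by
    refine (pi_norm_le_iff_of_nonneg (Finset.sum_nonneg fun i _ => abs_nonneg _)).2 fun i => ?_
    exact Finset.single_le_sum (f := fun i => |x i|) (fun i _ => abs_nonneg _) (Finset.mem_univ i)
  have h4 : (K : ℝ) * ‖x‖ ≤ K * ∑ i, |x i| := by gcongr
  simp only [Real.norm_eq_abs, Pi.add_apply] at h ⊢
  exact (h2.trans (by linarith)).trans (le_abs_self _)

theorem LipschitzWith.abs_lineDeriv_le {E : Type*} [NormedAddCommGroup E] [NormedSpace ℝ E]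
    {K : NNReal} {H : E → ℝ} (hH : LipschitzWith K H) (x v : E) :
    |lineDeriv ℝ H x v| ≤ K * ‖v‖ := by
  simpa using norm_lineDeriv_le_of_lipschitz ℝ hH

/-- The Poincaré inequality for the product of Laplace distributions. -/
theorem variance_pi_laplaceMeasure_le (n : ℕ) : ∀ {K : NNReal} {H : (Fin n → ℝ) → ℝ},
    LipschitzWith K H →
    Var[H; Measure.pi fun _ => laplaceMeasure] ≤
      4 * ∫ x, ∑ i, lineDeriv ℝ H x (Pi.single i 1) ^ 2 ∂Measure.pi fun _ => laplaceMeasure := by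
  induction n with
  | zero =>
    intro K H _
    have : H = fun _ => H 0 := funext fun x => congrArg H (Subsingleton.elim _ _)
    rw [this]
    simp [variance_eq_integral aemeasurable_const]
  | succ n ih =>
    intro K H hH
    set μ := Measure.pi fun _ : Fin n => laplaceMeasure with hμ
    have hmp := (measurePreserving_piFinSuccAbove (fun _ : Fin (n + 1) => laplaceMeasure) 0).symm
    have hcons : ∀ p : ℝ × (Fin n → ℝ),
        (MeasurableEquiv.piFinSuccAbove (fun _ : Fin (n + 1) => ℝ) 0).symm p
          = (Fin.cons p.1 p.2 : Fin (n + 1) → ℝ) := fun p => by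
      simp [MeasurableEquiv.piFinSuccAbove, Fin.insertNthEquiv]
    have hv := hmp.variance_fun_comp (f := H) hH.continuous.aemeasurable
    have hi := hmp.integral_comp'
      (fun x => ∑ i, lineDeriv ℝ H x (Pi.single i 1) ^ 2)
    simp only [hcons] at hv hi
    rw [← hv, ← hi]
    have l1 : ∀ y : Fin n → ℝ, LipschitzWith K fun x : ℝ => H (Fin.cons x y) := by
      intro y
      refine LipschitzWith.of_dist_le_mul fun x x' => (hH.dist_le_mul _ _).trans ?_
      gcongr
      refine (dist_pi_le_iff dist_nonneg).2 fun i => ?_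
      refine Fin.cases ?_ (fun j => ?_) i <;> simp
    have l2 : ∀ x : ℝ, LipschitzWith K fun y : Fin n → ℝ => H (Fin.cons x y) := by
      intro x
      refine LipschitzWith.of_dist_le_mul fun y y' => (hH.dist_le_mul _ _).trans ?_
      gcongr
      refine (dist_pi_le_iff dist_nonneg).2 fun i => ?_
      refine Fin.cases ?_ (fun j => ?_) i
      · simp
      · simpa using dist_le_pi_dist y y' j
    -- Both sides are derivatives of the same one-variable function, up to a shift of the variable,
    -- so the identity needs no differentiability of `H`.
    have d1 : ∀ (x : ℝ) (y : Fin n → ℝ), deriv (fun x : ℝ => H (Fin.cons x y)) x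
        = lineDeriv ℝ H (Fin.cons x y) (Pi.single 0 1) := by
      intro x y
      have : (fun t : ℝ => H (Fin.cons x y + t • Pi.single 0 1))
          = fun t => (fun x : ℝ => H (Fin.cons x y)) (x + t) := by
        funext t
        congr 1
        funext i
        refine Fin.cases ?_ (fun j => ?_) i <;> simp
      rw [lineDeriv, this, deriv_comp_const_add (fun x : ℝ => H (Fin.cons x y)), add_zero]
    have d2 : ∀ (x : ℝ) (y : Fin n → ℝ) (i : Fin n),
        lineDeriv ℝ (fun y : Fin n → ℝ => H (Fin.cons x y)) y (Pi.single i 1)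
        = lineDeriv ℝ H (Fin.cons x y) (Pi.single i.succ 1) := by
      intro x y i
      rw [lineDeriv, lineDeriv]
      congr 1
      funext t
      congr 1
      funext j
      refine Fin.cases ?_ (fun j => ?_) j
      · simp
      · simp [Pi.single_apply]
    have hfun : (fun p : ℝ × (Fin n → ℝ) => (Fin.cons p.1 p.2 : Fin (n + 1) → ℝ))
        = (MeasurableEquiv.piFinSuccAbove (fun _ : Fin (n + 1) => ℝ) 0).symm :=
      funext fun p => (hcons p).symm
    have hmeas : Measurable fun p : ℝ × (Fin n → ℝ) => (Fin.cons p.1 p.2 : Fin (n + 1) → ℝ) := by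
      rw [hfun]; exact MeasurableEquiv.measurable _
    have hint : ∀ i, Integrable (fun p : ℝ × (Fin n → ℝ) =>
        lineDeriv ℝ H (Fin.cons p.1 p.2) (Pi.single i 1) ^ 2) (laplaceMeasure.prod μ) := by
      intro i
      refine .of_bound ((((measurable_lineDeriv hH.continuous).comp
        hmeas).pow_const 2).aestronglyMeasurable) (((K : ℝ) * ‖(Pi.single i 1 : Fin (n + 1) → ℝ)‖) ^ 2)
        (.of_forall fun p => ?_)
      rw [norm_pow, Real.norm_eq_abs]
      gcongr
      exact hH.abs_lineDeriv_le _ _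
    have hmem : MemLp (fun p : ℝ × (Fin n → ℝ) => H (Fin.cons p.1 p.2)) 2
        (laplaceMeasure.prod μ) := by
      have := hH.memLp_two_pi_laplaceMeasure.comp_measurePreserving hmp
      simpa only [Function.comp_def, hcons] using this
    have hsum : Integrable (fun p : ℝ × (Fin n → ℝ) => ∑ i : Fin n,
        lineDeriv ℝ H (Fin.cons p.1 p.2) (Pi.single i.succ 1) ^ 2) (laplaceMeasure.prod μ) :=
      integrable_finsetSum _ fun i _ => hint i.succ
    -- Efron-Stein separates coordinate `0` from the other `n`. The one-dimensional inequality
    -- bounds the first term, the induction hypothesis the second, and the constant `4` does not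
    -- grow.
    refine (variance_prod_le hmem (fun y => (l1 y).memLp_two_laplaceMeasure)
      fun x => (l2 x).memLp_two_pi_laplaceMeasure).trans ?_
    simp only [Fin.sum_univ_succ]
    rw [integral_add (hint 0) hsum, mul_add, integral_prod_symm _ (hint 0),
      integral_prod _ hsum, ← integral_const_mul, ← integral_const_mul]
    refine add_le_add ?_ ?_
    · refine integral_mono_of_nonneg (.of_forall fun y => variance_nonneg _ _)
        ((hint 0).integral_prod_right.const_mul 4) (.of_forall fun y => ?_)
      simpa only [d1] using (l1 y).variance_laplaceMeasure_le
    · refine integral_mono_of_nonneg (.of_forall fun y => variance_nonneg _ _)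
        (hsum.integral_prod_left.const_mul 4) (.of_forall fun x => ?_)
      simpa only [d2] using ih (l2 x)

/-! ### Cone measure and surface measure on the `ℓ₁`-sphere. -/

/-- On an affine hyperplane which misses the origin, the cone measure is proportional to the
Hausdorff measure. -/
theorem exists_measure_cone_eq_mul_hausdorffMeasure {E : Type*} [NormedAddCommGroup E]
    [NormedSpace ℝ E] [FiniteDimensional ℝ E] [MeasurableSpace E] [BorelSpace E]
    (μ : Measure E) [μ.IsAddHaarMeasure] (s : E →L[ℝ] ℝ) (p : E) (hp : s p = 1) :
    ∃ c : NNReal, ∀ A : Set E, MeasurableSet A → (∀ x ∈ A, s x = 1) →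
      μ {x | s x ∈ Set.Ioo 0 1 ∧ (s x)⁻¹ • x ∈ A} =
        c * μH[(Module.finrank ℝ E : ℝ) - 1] A := by
  set W : Submodule ℝ E := LinearMap.ker s.toLinearMap with hW
  have hfin : (Module.finrank ℝ W : ℝ) = (Module.finrank ℝ E : ℝ) - 1 := by
    have hs : s.toLinearMap ≠ 0 := by
      intro h
      have := LinearMap.congr_fun h p
      simp [hp] at this
    have := Module.Dual.finrank_ker_add_one_of_ne_zero (f := s.toLinearMap) hs
    rw [← this, hW]
    simp
  have hmemW : ∀ y, y - s y • p ∈ W := fun y => by simp [hW, hp]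
  set π : E → W := fun y => ⟨y - s y • p, hmemW y⟩ with hπ
  have hπc : Continuous π := by
    refine Continuous.subtype_mk ?_ _
    fun_prop
  -- `q x` is the point where the ray through `x` meets the hyperplane `s = 1`, seen from the base
  -- point `p`.
  set q : E → W := fun x => π ((s x)⁻¹ • x) with hq
  have hqm : Measurable q := hπc.measurable.comp
    ((s.continuous.measurable.inv).smul measurable_id)
  set B : Set E := {x | s x ∈ Set.Ioo 0 1} with hB
  have hBm : MeasurableSet B := s.continuous.measurable measurableSet_Ioo
  have hqv : ∀ x ∈ B, x = s x • (p + (q x : E)) := by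
    intro x hx
    have : s x ≠ 0 := hx.1.ne'
    simp [hq, hπ, smul_smul, this]
  set κ : Measure W := (μ.restrict B).map q with hκ
  have hinv : κ.IsAddLeftInvariant := by
    constructor
    intro w
    have hsw : s (w : E) = 0 := w.2
    -- This shear has determinant `1` and preserves `s`, hence preserves `μ` on the slab `B`. Under
    -- `q` it becomes translation by `w`, which makes `κ` translation invariant.
    set T : E →ₗ[ℝ] E := LinearMap.transvection s.toLinearMap (w : E) with hT
    have hTx : ∀ x, T x = x + s x • (w : E) := fun x => by simp [hT, LinearMap.transvection]
    have hdet : LinearMap.det T = 1 := by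
      rw [hT, LinearMap.transvection.det]; simp
    have hTm : Measurable T := T.continuous_of_finiteDimensional.measurable
    have hTμ : μ.map T = μ := by
      rw [Measure.map_linearMap_addHaar_eq_smul_addHaar μ (by simp [hdet])]
      simp [hdet]
    have hsT : ∀ x, s (T x) = s x := fun x => by simp [hTx, hsw]
    have hTB : (μ.restrict B).map T = μ.restrict B := by
      have h1 : T ⁻¹' B = B := by ext x; simp [hB, hsT]
      conv_lhs => rw [← h1]
      rw [← Measure.restrict_map hTm hBm, hTμ]
    rw [hκ, Measure.map_map (by fun_prop) hqm]
    conv_rhs => rw [← hTB, Measure.map_map hqm hTm]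
    refine Measure.map_congr ?_
    filter_upwards [ae_restrict_mem hBm] with x hx
    have h0 : s x ≠ 0 := hx.1.ne'
    apply Subtype.ext
    simp only [Function.comp, hq, hπ, hsT, map_smul, Submodule.coe_add]
    rw [hTx, smul_add, smul_smul, inv_mul_cancel₀ h0, one_smul]
    abel
  have hcpt : IsFiniteMeasureOnCompacts κ := by
    constructor
    intro C hC
    obtain ⟨r, hr⟩ := hC.isBounded.exists_norm_le
    rw [hκ, Measure.map_apply hqm hC.measurableSet,
      Measure.restrict_apply (hqm hC.measurableSet)]
    refine (measure_mono (t := Metric.closedBall 0 (‖p‖ + r)) ?_).trans_lt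
      measure_closedBall_lt_top
    rintro x ⟨hxC, hx⟩
    have h1 : ‖(q x : E)‖ ≤ r := hr _ hxC
    rw [mem_closedBall_zero_iff, hqv x hx, norm_smul, Real.norm_of_nonneg hx.1.le]
    have h2 : ‖p + (q x : E)‖ ≤ ‖p‖ + r := (norm_add_le _ _).trans (by linarith)
    nlinarith [norm_nonneg (p + (q x : E)), hx.1, hx.2]
  -- Uniqueness of Haar measure on `W` makes `κ` a multiple of Hausdorff measure. The isometry `ι`
  -- below carries this to the affine hyperplane.
  have huniq := κ.isAddLeftInvariant_eq_smul μH[(Module.finrank ℝ W : ℝ)]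
  refine ⟨κ.addHaarScalarFactor μH[(Module.finrank ℝ W : ℝ)], fun A hA hA1 => ?_⟩
  set ι : W → E := fun w => p + w with hι
  have hιi : Isometry ι := (isometry_add_left p).comp isometry_subtype_coe
  have hAι : A ⊆ Set.range ι := fun x hx =>
    ⟨⟨x - p, by simp [hW, hA1 x hx, hp]⟩, by simp [hι]⟩
  have h1 : {x | s x ∈ Set.Ioo 0 1 ∧ (s x)⁻¹ • x ∈ A} = q ⁻¹' (ι ⁻¹' A) ∩ B := by
    ext x
    rw [Set.mem_inter_iff, and_comm (a := x ∈ q ⁻¹' (ι ⁻¹' A))]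
    refine and_congr_right fun hx => ?_
    have h0 : s x ≠ 0 := hx.1.ne'
    have : ι (q x) = (s x)⁻¹ • x := by simp [hι, hq, hπ, h0]
    rw [Set.mem_preimage, Set.mem_preimage, this]
  have hιA : MeasurableSet (ι ⁻¹' A) := hιi.continuous.measurable hA
  rw [h1, ← Measure.restrict_apply (hqm hιA), ← Measure.map_apply hqm hιA, ← hκ, ← hfin,
    DFunLike.congr_fun huniq (ι ⁻¹' A), Measure.smul_apply,
    hιi.hausdorffMeasure_preimage (Or.inl (Nat.cast_nonneg _)),
    Set.inter_eq_self_of_subset_left hAι, ENNReal.smul_def, smul_eq_mul]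

/-- The `ℓ₁`-norm on Euclidean space. -/
noncomputable def l1Norm {d : ℕ} (x : EuclideanSpace ℝ (Fin d)) : ℝ := ∑ i, |x i|

section l1Norm

variable {d : ℕ}

theorem l1Norm_nonneg (x : EuclideanSpace ℝ (Fin d)) : 0 ≤ l1Norm x :=
  Finset.sum_nonneg fun _ _ => abs_nonneg _

theorem abs_apply_le_l1Norm (x : EuclideanSpace ℝ (Fin d)) (i : Fin d) : |x i| ≤ l1Norm x :=
  Finset.single_le_sum (f := fun i => |x i|) (fun _ _ => abs_nonneg _) (Finset.mem_univ i)

theorem l1Norm_smul (r : ℝ) (x : EuclideanSpace ℝ (Fin d)) : l1Norm (r • x) = |r| * l1Norm x := by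
  simp [l1Norm, abs_mul, Finset.mul_sum]

theorem l1Norm_neg (x : EuclideanSpace ℝ (Fin d)) : l1Norm (-x) = l1Norm x := by
  simp [l1Norm]

theorem l1Norm_add_le (x y : EuclideanSpace ℝ (Fin d)) :
    l1Norm (x + y) ≤ l1Norm x + l1Norm y := by
  rw [l1Norm, l1Norm, l1Norm, ← Finset.sum_add_distrib]
  exact Finset.sum_le_sum fun i _ => abs_add_le _ _

theorem abs_l1Norm_sub_le (x y : EuclideanSpace ℝ (Fin d)) :
    |l1Norm x - l1Norm y| ≤ l1Norm (x - y) := by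
  have h1 := l1Norm_add_le (x - y) y
  have h2 := l1Norm_add_le (y - x) x
  rw [sub_add_cancel] at h1 h2
  rw [← l1Norm_neg (y - x), neg_sub] at h2
  rw [abs_le]
  constructor <;> linarith

@[fun_prop]
theorem continuous_l1Norm : Continuous (l1Norm : EuclideanSpace ℝ (Fin d) → ℝ) := by
  unfold l1Norm
  fun_prop

theorem l1Norm_zero : l1Norm (0 : EuclideanSpace ℝ (Fin d)) = 0 := by simp [l1Norm]

theorem l1Norm_eq_zero {x : EuclideanSpace ℝ (Fin d)} : l1Norm x = 0 ↔ x = 0 := by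
  refine ⟨fun h => ?_, fun h => h ▸ l1Norm_zero⟩
  ext i
  have := abs_apply_le_l1Norm x i
  rw [h] at this
  simpa using this

theorem norm_le_l1Norm (x : EuclideanSpace ℝ (Fin d)) : ‖x‖ ≤ l1Norm x := by
  rw [EuclideanSpace.norm_eq, Real.sqrt_le_left (l1Norm_nonneg x)]
  simp only [Real.norm_eq_abs]
  exact Finset.sum_sq_le_sq_sum_of_nonneg fun i _ => abs_nonneg (x i)

theorem l1Norm_sq_le (x : EuclideanSpace ℝ (Fin d)) : l1Norm x ^ 2 ≤ d * ‖x‖ ^ 2 := by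
  have := sq_sum_le_card_mul_sum_sq (s := Finset.univ) (f := fun i => |x i|)
  simpa [l1Norm, EuclideanSpace.norm_sq_eq] using this

theorem l1Norm_le_sqrt_mul_norm (x : EuclideanSpace ℝ (Fin d)) : l1Norm x ≤ √d * ‖x‖ := by
  rw [← Real.sqrt_sq (l1Norm_nonneg x), ← Real.sqrt_sq (norm_nonneg x),
    ← Real.sqrt_mul (Nat.cast_nonneg d)]
  exact Real.sqrt_le_sqrt (l1Norm_sq_le x)

theorem mem_l1Sphere {x : EuclideanSpace ℝ (Fin d)} : x ∈ l1Sphere d ↔ l1Norm x = 1 := Iff.rfl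

theorem measurableSet_l1Sphere : MeasurableSet (l1Sphere d) :=
  continuous_l1Norm.measurable (measurableSet_singleton 1)

/-- The law of the `ℓ₁`-normalization of a point of the unit `ℓ₁`-ball, without normalization of
the total mass. -/
noncomputable def l1ConeMeasure (d : ℕ) : Measure (EuclideanSpace ℝ (Fin d)) :=
  (volume.restrict {x | l1Norm x ∈ Set.Ioo 0 1}).map fun x => (l1Norm x)⁻¹ • x

theorem measurableSet_l1Norm_mem_Ioo :
    MeasurableSet {x : EuclideanSpace ℝ (Fin d) | l1Norm x ∈ Set.Ioo 0 1} :=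
  continuous_l1Norm.measurable measurableSet_Ioo

theorem measurable_l1Normalize :
    Measurable fun x : EuclideanSpace ℝ (Fin d) => (l1Norm x)⁻¹ • x :=
  continuous_l1Norm.measurable.inv.smul measurable_id

theorem l1ConeMeasure_apply {A : Set (EuclideanSpace ℝ (Fin d))} (hA : MeasurableSet A) :
    l1ConeMeasure d A = volume {x : EuclideanSpace ℝ (Fin d) |
      l1Norm x ∈ Set.Ioo 0 1 ∧ (l1Norm x)⁻¹ • x ∈ A} := by
  rw [l1ConeMeasure, Measure.map_apply measurable_l1Normalize hA,
    Measure.restrict_apply (measurable_l1Normalize hA)]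
  congr 1
  ext x
  simp [and_comm]

theorem l1ConeMeasure_compl_l1Sphere : l1ConeMeasure d (l1Sphere d)ᶜ = 0 := by
  rw [l1ConeMeasure_apply measurableSet_l1Sphere.compl]
  convert! measure_empty (μ := (volume : Measure (EuclideanSpace ℝ (Fin d))))
  ext x
  simp only [Set.mem_ofPred_eq, Set.mem_compl_iff, mem_l1Sphere, Set.mem_empty_iff_false, iff_false,
    not_and, not_not]
  intro hx
  rw [l1Norm_smul, abs_of_pos (inv_pos.2 hx.1), inv_mul_cancel₀ hx.1.ne']

/-- The reflection which changes the signs of the coordinates where `σ` is false. -/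
noncomputable def signReflection (σ : Fin d → Bool) :
    EuclideanSpace ℝ (Fin d) ≃ₗᵢ[ℝ] EuclideanSpace ℝ (Fin d) :=
  LinearIsometryEquiv.piLpCongrRight 2 fun i =>
    if σ i then LinearIsometryEquiv.refl ℝ ℝ else LinearIsometryEquiv.neg ℝ

theorem signReflection_apply (σ : Fin d → Bool) (x : EuclideanSpace ℝ (Fin d)) (i : Fin d) :
    signReflection σ x i = if σ i then x i else -x i := by
  simp only [signReflection, LinearIsometryEquiv.piLpCongrRight_apply]
  split_ifs <;> simp_all

theorem signReflection_signReflection (σ : Fin d → Bool) (x : EuclideanSpace ℝ (Fin d)) :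
    signReflection σ (signReflection σ x) = x := by
  ext i
  simp only [signReflection_apply]
  split_ifs <;> simp

theorem exists_l1ConeMeasure_eq_mul_hausdorffMeasure (hd : 0 < d) :
    ∃ c : NNReal, ∀ A : Set (EuclideanSpace ℝ (Fin d)), MeasurableSet A → A ⊆ l1Sphere d →
      l1ConeMeasure d A = c * μH[(d : ℝ) - 1] A := by
  set s : EuclideanSpace ℝ (Fin d) →L[ℝ] ℝ := ∑ i, EuclideanSpace.proj i with hs
  have hsx : ∀ x, s x = ∑ i, x i := fun x => by simp [hs]
  obtain ⟨c, hc⟩ := exists_measure_cone_eq_mul_hausdorffMeasure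
    (volume : Measure (EuclideanSpace ℝ (Fin d))) s (EuclideanSpace.single ⟨0, hd⟩ 1)
    (by simp [hsx])
  rw [finrank_euclideanSpace_fin] at hc
  refine ⟨c, fun A hA hAS => ?_⟩
  -- `N` records the orthant of a point. Inside one orthant the sphere lies in a hyperplane, so the
  -- previous result applies orthant by orthant.
  set N : EuclideanSpace ℝ (Fin d) → Fin d → Bool := fun x i => decide (0 ≤ x i) with hN
  have hNm : Measurable N := by
    refine measurable_pi_lambda _ fun i => measurable_to_bool ?_
    have : (fun x : EuclideanSpace ℝ (Fin d) => decide (0 ≤ x i)) ⁻¹' {true} = {x | 0 ≤ x i} := by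
      ext x; simp
    rw [this]
    exact measurableSet_le measurable_const (by fun_prop)
  have hpart : ∀ m : Measure (EuclideanSpace ℝ (Fin d)),
      m A = ∑ σ, m (N ⁻¹' {σ} ∩ A) := by
    intro m
    have h := sum_measure_preimage_singleton (μ := m.restrict A) (f := N) Finset.univ
      fun σ _ => hNm (measurableSet_singleton σ)
    simp only [Finset.coe_univ, Set.preimage_univ, Measure.restrict_apply_univ] at h
    rw [← h]
    exact Finset.sum_congr rfl fun σ _ =>
      Measure.restrict_apply (hNm (measurableSet_singleton σ))
  rw [hpart, hpart μH[(d : ℝ) - 1], Finset.mul_sum]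
  refine Finset.sum_congr rfl fun σ _ => ?_
  -- `D` maps the orthant of `σ` into the nonnegative one, where `l1Norm` equals `s`. It preserves
  -- both volume and Hausdorff measure, so a single `c` serves all orthants.
  set D := signReflection σ with hD
  set B := N ⁻¹' {σ} ∩ A with hB
  have hBm : MeasurableSet B := (hNm (measurableSet_singleton σ)).inter hA
  have hDm : Measurable D := D.continuous.measurable
  have hsD : ∀ y ∈ B, s (D y) = l1Norm y := by
    rintro y ⟨hy, -⟩
    rw [hsx, l1Norm]
    refine Finset.sum_congr rfl fun i _ => ?_
    have hi : decide (0 ≤ y i) = σ i := congrFun hy i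
    rw [hD, signReflection_apply, ← hi]
    by_cases h : 0 ≤ y i
    · simp [h, abs_of_nonneg h]
    · simp [h, abs_of_neg (not_le.1 h)]
  have hB1 : ∀ y ∈ B, l1Norm y = 1 := fun y hy => hAS hy.2
  have key := hc (D ⁻¹' B) (hDm hBm) (fun x hx => by
    have h := hsD (D x) hx
    rwa [hD, signReflection_signReflection, ← hD, hB1 _ hx] at h)
  have hpre : D ⁻¹' {x | s x ∈ Set.Ioo 0 1 ∧ (s x)⁻¹ • x ∈ D ⁻¹' B}
      = {x | l1Norm x ∈ Set.Ioo 0 1 ∧ (l1Norm x)⁻¹ • x ∈ B} := by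
    ext x
    simp only [Set.mem_preimage, Set.mem_ofPred_eq, map_smul]
    rw [hD, signReflection_signReflection, ← hD]
    constructor
    · rintro ⟨h1, h2⟩
      have h3 := hB1 _ h2
      rw [l1Norm_smul, abs_of_pos (inv_pos.2 h1.1), inv_mul_eq_one₀ h1.1.ne'] at h3
      rw [← h3]
      exact ⟨h1, h2⟩
    · rintro ⟨h1, h2⟩
      have h3 := hsD _ h2
      rw [hB1 _ h2, map_smul, map_smul, smul_eq_mul, inv_mul_eq_one₀ h1.1.ne'] at h3
      rw [← h3]
      exact ⟨h1, h2⟩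
  have hDp : ∀ C : Set (EuclideanSpace ℝ (Fin d)), volume (D ⁻¹' C) = volume C := fun C =>
    D.measurePreserving.measure_preimage_emb D.toHomeomorph.measurableEmbedding C
  rw [l1ConeMeasure_apply hBm, ← hpre,
    hDp, key,
    D.isometry.hausdorffMeasure_preimage (Or.inr D.surjective),
    D.surjective.range_eq, Set.inter_univ]

theorem l1ConeMeasure_univ_ne_zero (hd : 0 < d) : l1ConeMeasure d Set.univ ≠ 0 := by
  rw [l1ConeMeasure_apply MeasurableSet.univ]
  simp only [Set.mem_univ, and_true]
  refine (IsOpen.measure_pos _ (isOpen_Ioo.preimage continuous_l1Norm)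
    ⟨EuclideanSpace.single ⟨0, hd⟩ (1 / 2), ?_⟩).ne'
  have : l1Norm (EuclideanSpace.single (⟨0, hd⟩ : Fin d) (1 / 2 : ℝ)) = 1 / 2 := by
    simp [l1Norm, apply_ite]
  rw [Set.mem_preimage, this]
  constructor <;> norm_num

/-- The factor relating cone measure to Hausdorff measure cancels on normalization. It is nonzero
because the open ball has positive volume. -/
theorem IsUniformOnL1Sphere.map_eq {Ω : Type*} [MeasurableSpace Ω] {P : Measure Ω}
    [IsProbabilityMeasure P] (hd : 0 < d) {ζ : Ω → EuclideanSpace ℝ (Fin d)} (hm : Measurable ζ)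
    (h : IsUniformOnL1Sphere P ζ) :
    P.map ζ = (l1ConeMeasure d Set.univ)⁻¹ • l1ConeMeasure d := by
  obtain ⟨c, hc⟩ := exists_l1ConeMeasure_eq_mul_hausdorffMeasure hd
  have hS := measurableSet_l1Sphere (d := d)
  have hν : P.map ζ = cond μH[(d : ℝ) - 1] (l1Sphere d) := h
  have hprob : P.map ζ Set.univ = 1 := by
    rw [Measure.map_apply hm MeasurableSet.univ]; simp
  have hκ : ∀ A, MeasurableSet A →
      l1ConeMeasure d A = c * μH[(d : ℝ) - 1] (l1Sphere d ∩ A) := by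
    intro A hA
    rw [← hc _ (hS.inter hA) Set.inter_subset_left, Set.inter_comm,
      measure_inter_conull' (measure_mono_null (fun x hx => hx.2) l1ConeMeasure_compl_l1Sphere)]
  rw [hν, cond_apply hS, Set.inter_univ] at hprob
  have h0 : μH[(d : ℝ) - 1] (l1Sphere d) ≠ 0 := by
    intro h0; simp [h0] at hprob
  have htop : μH[(d : ℝ) - 1] (l1Sphere d) ≠ ⊤ := by
    intro h0; simp [h0] at hprob
  have hu := hκ Set.univ MeasurableSet.univ
  rw [Set.inter_univ] at hu
  have hc0 : (c : ENNReal) ≠ 0 := by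
    intro h0
    rw [h0, zero_mul] at hu
    exact l1ConeMeasure_univ_ne_zero hd hu
  ext A hA
  rw [hν, cond_apply hS, Measure.smul_apply, hu, hκ A hA, smul_eq_mul,
    ENNReal.mul_inv (Or.inl hc0) (Or.inl ENNReal.coe_ne_top),
    mul_mul_mul_comm, ENNReal.inv_mul_cancel hc0 ENNReal.coe_ne_top, one_mul]

end l1Norm

/-! ### Polar coordinates for the `ℓ₁`-norm. -/

/-- The measure on the half-line `r > 0` with density `r ^ (d - 1)`. -/
noncomputable def radialMeasure (d : ℕ) : Measure ℝ :=
  (volume.restrict (Set.Ioi 0)).withDensity fun r => ENNReal.ofReal (r ^ (d - 1))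

instance (d : ℕ) : SFinite (radialMeasure d) := by unfold radialMeasure; infer_instance

theorem map_volumeIoiPow (d : ℕ) :
    (Measure.volumeIoiPow (d - 1)).map Subtype.val = radialMeasure d := by
  ext s hs
  rw [Measure.map_apply measurable_subtype_coe hs, Measure.volumeIoiPow, radialMeasure,
    withDensity_apply _ (measurable_subtype_coe hs), withDensity_apply _ hs,
    Measure.restrict_restrict hs,
    setLIntegral_subtype measurableSet_Ioi _ fun a : ℝ => .ofReal (a ^ (d - 1)),
    Subtype.image_preimage_coe, Set.inter_comm]

theorem ae_radialMeasure_pos (d : ℕ) : ∀ᵐ r ∂radialMeasure d, 0 < r :=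
  (withDensity_absolutelyContinuous _ _).ae_le (ae_restrict_mem measurableSet_Ioi)

theorem integral_radialMeasure (d : ℕ) (ψ : ℝ → ℝ) :
    ∫ r, ψ r ∂radialMeasure d = ∫ r in Set.Ioi 0, r ^ (d - 1) * ψ r := by
  rw [radialMeasure, integral_withDensity_eq_integral_toReal_smul (by fun_prop) (by simp)]
  refine setIntegral_congr_fun measurableSet_Ioi fun r hr => ?_
  have hr : 0 < r := hr
  simp [ENNReal.toReal_ofReal (pow_nonneg hr.le _)]

theorem radialMeasure_Iio_one {d : ℕ} (hd : 0 < d) :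
    radialMeasure d (Set.Iio 1) = ENNReal.ofReal (1 / d) := by
  rw [← map_volumeIoiPow, Measure.map_apply measurable_subtype_coe measurableSet_Iio]
  have h := Measure.volumeIoiPow_apply_Iio (d - 1) ⟨1, Set.mem_Ioi.2 one_pos⟩
  convert! h using 2
  simp [Nat.cast_sub (Nat.one_le_of_lt hd)]

/-- Polar coordinates for the `ℓ₁`-norm, with an unspecified angular measure. -/
theorem exists_volume_eq_map_l1Polar {d : ℕ} (hd : 0 < d) :
    ∃ τ : Measure (EuclideanSpace ℝ (Fin d)), IsFiniteMeasure τ ∧ τ (l1Sphere d)ᶜ = 0 ∧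
      (volume : Measure (EuclideanSpace ℝ (Fin d))) =
        (τ.prod (radialMeasure d)).map fun p => p.2 • p.1 := by
  have : Nonempty (Fin d) := ⟨⟨0, hd⟩⟩
  -- Polar decomposition is available for the norm of any finite-dimensional space. It is applied to
  -- `PiLp 1` and transported by the coordinatewise identity `j`.
  let j : PiLp 1 (fun _ : Fin d => ℝ) ≃L[ℝ] EuclideanSpace ℝ (Fin d) :=
    (PiLp.continuousLinearEquiv 1 ℝ (fun _ : Fin d => ℝ)).trans
      (PiLp.continuousLinearEquiv 2 ℝ (fun _ : Fin d => ℝ)).symm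
  have hj : ∀ x i, j x i = x i := fun x i => rfl
  have hjn : ∀ x, l1Norm (j x) = ‖x‖ := fun x => by
    rw [PiLp.norm_eq_of_L1]; rfl
  have hjm : Measurable j := j.continuous.measurable
  set μ : Measure (PiLp 1 (fun _ : Fin d => ℝ)) := volume.map j.symm with hμ
  have : μ.IsAddHaarMeasure := j.symm.isAddHaarMeasure_map volume
  have hvol : (volume : Measure (EuclideanSpace ℝ (Fin d))) = μ.map j := by
    rw [hμ, Measure.map_map hjm j.symm.continuous.measurable]
    simp
  have hfr : Module.finrank ℝ (PiLp 1 (fun _ : Fin d => ℝ)) = d := by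
    rw [j.toLinearEquiv.finrank_eq, finrank_euclideanSpace_fin]
  have : Nontrivial (PiLp 1 (fun _ : Fin d => ℝ)) :=
    Module.nontrivial_of_finrank_pos (R := ℝ) (by rw [hfr]; exact hd)
  set e := homeomorphUnitSphereProd (PiLp 1 (fun _ : Fin d => ℝ)) with he
  have hmp := μ.measurePreserving_homeomorphUnitSphereProd
  rw [hfr, ← he] at hmp
  have hes : Measurable e.symm := e.symm.measurable
  have h1 : (μ.toSphere.prod (Measure.volumeIoiPow (d - 1))).map
      (fun q => (e.symm q).1) = μ := by
    have h2 : (μ.toSphere.prod (Measure.volumeIoiPow (d - 1))).map e.symm =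
        μ.comap Subtype.val := by
      rw [← hmp.map_eq, Measure.map_map hes e.measurable]
      simp
    have h3 : (μ.comap (Subtype.val : ({0}ᶜ : Set (PiLp 1 (fun _ : Fin d => ℝ))) → _)).map
        Subtype.val = μ := by
      rw [map_comap_subtype_coe (measurableSet_singleton _).compl,
        Measure.restrict_eq_self_of_ae_mem]
      exact compl_mem_ae_iff.2 (measure_singleton 0)
    rw [← h2, Measure.map_map measurable_subtype_coe hes] at h3
    exact h3
  set k : Metric.sphere (0 : PiLp 1 (fun _ : Fin d => ℝ)) 1 → EuclideanSpace ℝ (Fin d) :=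
    fun θ => j θ with hk
  have hkm : Measurable k := hjm.comp measurable_subtype_coe
  refine ⟨μ.toSphere.map k, inferInstance, ?_, ?_⟩
  · rw [Measure.map_apply hkm measurableSet_l1Sphere.compl]
    convert! measure_empty (μ := μ.toSphere)
    ext θ
    simp [hk, mem_l1Sphere, hjn]
  · rw [← map_volumeIoiPow, Measure.map_prod_map _ _ hkm measurable_subtype_coe,
      Measure.map_map (by fun_prop) (hkm.prodMap measurable_subtype_coe)]
    rw [hvol]
    have hem : Measurable fun q => (e.symm q).1 := measurable_subtype_coe.comp hes
    conv_lhs => rw [← h1, Measure.map_map hjm hem]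
    refine congrArg (fun g => Measure.map g _) (funext fun q => ?_)
    exact j.map_smul q.2.1 q.1.1

/-- In polar coordinates the cone over `A` is almost everywhere `A × (0, 1)`, and the radial mass of
`(0, 1)` is `1 / d`. This identifies the unspecified angular measure `τ`. -/
theorem l1ConeMeasure_eq_smul {d : ℕ} (hd : 0 < d) {τ : Measure (EuclideanSpace ℝ (Fin d))}
    [IsFiniteMeasure τ] (hτ : τ (l1Sphere d)ᶜ = 0)
    (hvol : (volume : Measure (EuclideanSpace ℝ (Fin d))) =
      (τ.prod (radialMeasure d)).map fun p => p.2 • p.1) :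
    l1ConeMeasure d = ENNReal.ofReal (1 / d) • τ := by
  ext A hA
  have hm : Measurable fun p : EuclideanSpace ℝ (Fin d) × ℝ => p.2 • p.1 := by fun_prop
  rw [l1ConeMeasure_apply hA, hvol, Measure.map_apply hm, Measure.smul_apply, smul_eq_mul,
    ← radialMeasure_Iio_one hd, mul_comm, ← Measure.prod_prod]
  · refine measure_congr ?_
    have h1 : ∀ᵐ p ∂(τ.prod (radialMeasure d)), p.1 ∈ l1Sphere d :=
      Measure.quasiMeasurePreserving_fst.ae (show ∀ᵐ θ ∂τ, θ ∈ l1Sphere d from hτ)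
    have h2 : ∀ᵐ p ∂(τ.prod (radialMeasure d)), 0 < p.2 :=
      Measure.quasiMeasurePreserving_snd.ae (ae_radialMeasure_pos d)
    filter_upwards [h1, h2] with p hp1 hp2
    have hn : l1Norm (p.2 • p.1) = p.2 := by
      rw [l1Norm_smul, mem_l1Sphere.1 hp1, abs_of_pos hp2, mul_one]
    apply propext
    change (_ ∧ _) ↔ (_ ∧ _)
    simp only [hn, smul_smul, inv_mul_cancel₀ hp2.ne', one_smul, Set.mem_Ioo, hp2, true_and,
      Set.mem_Iio]
    exact and_comm
  · exact measurableSet_l1Norm_mem_Ioo.inter (measurable_l1Normalize hA)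

/-- Polar coordinates for the `ℓ₁`-norm, with the uniform distribution on the sphere as angular
measure. -/
theorem IsUniformOnL1Sphere.exists_volume_eq {d : ℕ} (hd : 0 < d) {Ω : Type*} [MeasurableSpace Ω]
    {P : Measure Ω} [IsProbabilityMeasure P] {ζ : Ω → EuclideanSpace ℝ (Fin d)}
    (hm : Measurable ζ) (h : IsUniformOnL1Sphere P ζ) :
    ∃ C : ENNReal, C ≠ 0 ∧ C ≠ ⊤ ∧ P.map ζ (l1Sphere d)ᶜ = 0 ∧
      (volume : Measure (EuclideanSpace ℝ (Fin d))) =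
        C • ((P.map ζ).prod (radialMeasure d)).map fun p => p.2 • p.1 := by
  obtain ⟨τ, hfin, hτ, hvol⟩ := exists_volume_eq_map_l1Polar hd
  have hκ := l1ConeMeasure_eq_smul hd hτ hvol
  have h1 := h.map_eq hd hm
  have hκ0 := l1ConeMeasure_univ_ne_zero hd
  have hd' : ENNReal.ofReal (1 / d) ≠ 0 := by simpa using hd.ne'
  have hτ0 : τ Set.univ ≠ 0 := by
    intro h0
    rw [hκ, Measure.smul_apply, h0] at hκ0
    simp at hκ0
  rw [hκ, Measure.smul_apply, smul_eq_mul,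
    ENNReal.mul_inv (Or.inl hd') (Or.inl ENNReal.ofReal_ne_top), smul_smul,
    mul_comm, ← mul_assoc, ENNReal.mul_inv_cancel hd' ENNReal.ofReal_ne_top, one_mul] at h1
  refine ⟨τ Set.univ, hτ0, measure_ne_top _ _, ?_, ?_⟩
  · rw [h1, Measure.smul_apply, hτ, smul_zero]
  · rw [h1, Measure.prod_smul_left, Measure.map_smul, smul_smul,
      ENNReal.mul_inv_cancel hτ0 (measure_ne_top _ _), one_smul]
    exact hvol

theorem integral_l1Polar {d : ℕ} {C : ENNReal} {ν : Measure (EuclideanSpace ℝ (Fin d))}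
    (hvol : (volume : Measure (EuclideanSpace ℝ (Fin d))) =
      C • (ν.prod (radialMeasure d)).map fun p => p.2 • p.1)
    {G : EuclideanSpace ℝ (Fin d) → ℝ} (hG : Measurable G) :
    ∫ x, G x = C.toReal * ∫ p, G (p.2 • p.1) ∂(ν.prod (radialMeasure d)) := by
  rw [hvol, integral_smul_measure, integral_map (by fun_prop) hG.aestronglyMeasurable, smul_eq_mul]

/-- This is the independence of radius and direction: a function that splits in polar coordinates
has an integral that splits. -/
theorem integral_l1Polar_mul {d : ℕ} {C : ENNReal} {ν : Measure (EuclideanSpace ℝ (Fin d))}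
    [SFinite ν] (hν : ν (l1Sphere d)ᶜ = 0)
    (hvol : (volume : Measure (EuclideanSpace ℝ (Fin d))) =
      C • (ν.prod (radialMeasure d)).map fun p => p.2 • p.1)
    {G : EuclideanSpace ℝ (Fin d) → ℝ} (hG : Measurable G)
    (φ : EuclideanSpace ℝ (Fin d) → ℝ) (ψ : ℝ → ℝ)
    (h : ∀ r θ, 0 < r → l1Norm θ = 1 → G (r • θ) = φ θ * ψ r) :
    ∫ x, G x = C.toReal * ((∫ θ, φ θ ∂ν) * ∫ r in Set.Ioi 0, r ^ (d - 1) * ψ r) := by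
  rw [integral_l1Polar hvol hG, ← integral_radialMeasure, ← integral_prod_mul]
  congr 1
  refine integral_congr_ae ?_
  have h1 : ∀ᵐ p ∂(ν.prod (radialMeasure d)), p.1 ∈ l1Sphere d :=
    Measure.quasiMeasurePreserving_fst.ae (show ∀ᵐ θ ∂ν, θ ∈ l1Sphere d from hν)
  have h2 : ∀ᵐ p ∂(ν.prod (radialMeasure d)), 0 < p.2 :=
    Measure.quasiMeasurePreserving_snd.ae (ae_radialMeasure_pos d)
  filter_upwards [h1, h2] with p hp1 hp2
  exact h _ _ hp2 hp1

/-! ### The product Laplace distribution in `ℓ₁`-polar coordinates. -/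

theorem pi_laplaceMeasure_eq_withDensity (n : ℕ) :
    (Measure.pi fun _ : Fin n => laplaceMeasure) =
      volume.withDensity fun x => ENNReal.ofReal (∏ i, Real.exp (-|x i|) / 2) := by
  refine Measure.pi_eq fun s hs => ?_
  have hint : Integrable fun x : ℝ => Real.exp (-|x|) / 2 := by
    simpa using ((integrable_abs_pow_mul_exp_neg_abs 0).div_const 2)
  have hr : ∀ i, ∫⁻ x in s i, ENNReal.ofReal (Real.exp (-|x|) / 2) =
      ENNReal.ofReal (∫ x in s i, Real.exp (-|x|) / 2) := fun i =>
    (ofReal_integral_eq_lintegral_ofReal hint.integrableOn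
      (.of_forall fun x => by positivity)).symm
  rw [withDensity_apply _ (MeasurableSet.univ_pi hs), volume_pi, Measure.restrict_pi_pi,
    ← ofReal_integral_eq_lintegral_ofReal
      (Integrable.fintype_prod fun i => hint.integrableOn)
      (.of_forall fun x => by positivity),
    integral_fintype_prod_eq_prod (fun _ x => Real.exp (-|x|) / 2),
    ENNReal.ofReal_prod_of_nonneg fun i _ => integral_nonneg fun x => by positivity]
  refine Finset.prod_congr rfl fun i _ => ?_
  rw [laplaceMeasure, withDensity_apply _ (hs i), hr]

theorem pi_laplaceMeasure_absolutelyContinuous (n : ℕ) :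
    (Measure.pi fun _ : Fin n => laplaceMeasure) ≪ volume := by
  rw [pi_laplaceMeasure_eq_withDensity]
  exact withDensity_absolutelyContinuous _ _

/-- The density depends on the point only through `l1Norm`. This is the reason for using Laplace
coordinates: polar integration then recovers the uniform law on the sphere. -/
theorem integral_pi_laplaceMeasure {n : ℕ} (G : EuclideanSpace ℝ (Fin n) → ℝ) :
    ∫ x, G (WithLp.toLp 2 x) ∂(Measure.pi fun _ : Fin n => laplaceMeasure) =
      (2 ^ n)⁻¹ * ∫ x, Real.exp (-l1Norm x) * G x := by
  rw [pi_laplaceMeasure_eq_withDensity,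
    integral_withDensity_eq_integral_toReal_smul (by fun_prop) (by simp),
    ← (PiLp.volume_preserving_toLp (Fin n)).integral_comp
      (MeasurableEquiv.toLp 2 (Fin n → ℝ)).measurableEmbedding, ← integral_const_mul]
  refine integral_congr_ae (.of_forall fun x => ?_)
  have : ∏ i, Real.exp (-|x i|) / 2 = (2 ^ n)⁻¹ * Real.exp (-l1Norm (WithLp.toLp 2 x)) := by
    rw [Finset.prod_div_distrib, ← Real.exp_sum, Finset.sum_neg_distrib]
    simp [l1Norm, div_eq_inv_mul]
  simp only []
  rw [ENNReal.toReal_ofReal (by positivity), this, smul_eq_mul, mul_assoc]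

theorem integral_pow_mul_radial (d k : ℕ) (hd : 0 < d) :
    ∫ r in Set.Ioi (0 : ℝ), r ^ (d - 1) * (Real.exp (-r) * r ^ k) = (d + k - 1).factorial := by
  rw [← Real.Gamma_nat_eq_factorial, Real.Gamma_eq_integral (by positivity)]
  refine setIntegral_congr_fun measurableSet_Ioi fun r _ => ?_
  have : ((d + k - 1 : ℕ) : ℝ) + 1 - 1 = ((d - 1 + k : ℕ) : ℝ) := by
    rw [add_sub_cancel_right]
    congr 1
    omega
  simp only [this, Real.rpow_natCast, pow_add]
  ring

/-! ### Homogeneous extension of a function from the sphere, and its gradient. -/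

/-- The map `x ↦ ‖x‖₁ F(x / ‖x‖₁)`. -/
noncomputable def l1Homogenize {d : ℕ} (F : EuclideanSpace ℝ (Fin d) → ℝ)
    (x : EuclideanSpace ℝ (Fin d)) : ℝ :=
  l1Norm x * F ((l1Norm x)⁻¹ • x)

section

variable {d : ℕ} {F : EuclideanSpace ℝ (Fin d) → ℝ}

theorem l1Norm_smul_l1Normalize (x : EuclideanSpace ℝ (Fin d)) :
    l1Norm x • (l1Norm x)⁻¹ • x = x := by
  by_cases h : l1Norm x = 0
  · rw [l1Norm_eq_zero.1 h]; simp
  · rw [smul_smul, mul_inv_cancel₀ h, one_smul]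

theorem norm_l1Normalize_le_one (x : EuclideanSpace ℝ (Fin d)) :
    ‖(l1Norm x)⁻¹ • x‖ ≤ 1 := by
  refine (norm_le_l1Norm _).trans ?_
  rw [l1Norm_smul, abs_inv, abs_of_nonneg (l1Norm_nonneg x)]
  exact inv_mul_le_one

theorem measurable_l1Homogenize (hF : LipschitzWith 1 F) : Measurable (l1Homogenize F) :=
  continuous_l1Norm.measurable.mul (hF.continuous.measurable.comp measurable_l1Normalize)

theorem abs_le_norm_of_odd (hF : LipschitzWith 1 F) (hodd : ∀ θ, F (-θ) = -F θ)
    (θ : EuclideanSpace ℝ (Fin d)) : |F θ| ≤ ‖θ‖ := by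
  have h0 : F 0 = 0 := by
    have := hodd 0
    rw [neg_zero] at this
    linarith
  simpa [h0, Real.dist_eq] using hF.dist_le_mul θ 0

/-- Oddness gives `F 0 = 0`, hence `|F θ| ≤ ‖θ‖`, and a change of the `ℓ₁`-norm costs at most `√d ‖y
- x‖`. The factor `‖θ‖` at the fixed point `x` is kept rather than bounded by `1`, since its mean
square is only `2 / (d + 1)`. -/
theorem abs_l1Homogenize_sub_le (hF : LipschitzWith 1 F) (hodd : ∀ θ, F (-θ) = -F θ)
    (x y : EuclideanSpace ℝ (Fin d)) :
    |l1Homogenize F y - l1Homogenize F x| ≤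
      (1 + 2 * √d * ‖(l1Norm x)⁻¹ • x‖) * ‖y - x‖ := by
  set θ := (l1Norm x)⁻¹ • x with hθ
  have hx : x = l1Norm x • θ := (l1Norm_smul_l1Normalize x).symm
  have hn := l1Norm_nonneg y
  have hr : |l1Norm y - l1Norm x| ≤ √d * ‖y - x‖ :=
    (abs_l1Norm_sub_le y x).trans (l1Norm_le_sqrt_mul_norm _)
  have h1 : l1Norm y * |F ((l1Norm y)⁻¹ • y) - F θ| ≤
      ‖y - x‖ + |l1Norm y - l1Norm x| * ‖θ‖ := by
    have h2 : |F ((l1Norm y)⁻¹ • y) - F θ| ≤ ‖(l1Norm y)⁻¹ • y - θ‖ := by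
      simpa [Real.dist_eq, dist_eq_norm] using hF.dist_le_mul ((l1Norm y)⁻¹ • y) θ
    calc l1Norm y * |F ((l1Norm y)⁻¹ • y) - F θ|
        ≤ l1Norm y * ‖(l1Norm y)⁻¹ • y - θ‖ := by gcongr
      _ = ‖l1Norm y • ((l1Norm y)⁻¹ • y - θ)‖ := by
          rw [norm_smul, Real.norm_of_nonneg hn]
      _ = ‖(y - x) - (l1Norm y - l1Norm x) • θ‖ := by
          congr 1
          rw [smul_sub, l1Norm_smul_l1Normalize, sub_smul, ← hx]
          abel
      _ ≤ ‖y - x‖ + ‖(l1Norm y - l1Norm x) • θ‖ := norm_sub_le _ _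
      _ = _ := by rw [norm_smul, Real.norm_eq_abs]
  have h3 := abs_le_norm_of_odd hF hodd θ
  have h4 : l1Homogenize F y - l1Homogenize F x =
      l1Norm y * (F ((l1Norm y)⁻¹ • y) - F θ) + (l1Norm y - l1Norm x) * F θ := by
    simp only [l1Homogenize, hθ]; ring
  rw [h4]
  refine (abs_add_le _ _).trans ?_
  rw [abs_mul, abs_mul, abs_of_nonneg hn]
  have h5 : |l1Norm y - l1Norm x| * |F θ| ≤ |l1Norm y - l1Norm x| * ‖θ‖ := by gcongr
  have h6 : |l1Norm y - l1Norm x| * ‖θ‖ ≤ √d * ‖y - x‖ * ‖θ‖ := by gcongr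
  linarith

theorem exists_lipschitzWith_l1Homogenize_toLp (hF : LipschitzWith 1 F)
    (hodd : ∀ θ, F (-θ) = -F θ) :
    ∃ K, LipschitzWith K fun x : Fin d → ℝ => l1Homogenize F (WithLp.toLp 2 x) := by
  refine ⟨Real.toNNReal ((1 + 2 * √d) * d), LipschitzWith.of_dist_le_mul fun x y => ?_⟩
  rw [Real.coe_toNNReal _ (by positivity), Real.dist_eq, dist_eq_norm]
  refine (abs_l1Homogenize_sub_le hF hodd _ _).trans ?_
  rw [mul_assoc (1 + 2 * √(d : ℝ)), ← WithLp.toLp_sub]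
  have h1 : ‖WithLp.toLp 2 (x - y)‖ ≤ d * ‖x - y‖ := by
    refine (norm_le_l1Norm _).trans ?_
    have : ∀ i ∈ Finset.univ, |(x - y) i| ≤ ‖x - y‖ := fun i _ => norm_le_pi_norm (x - y) i
    simpa [l1Norm] using Finset.sum_le_card_nsmul _ _ _ this
  have h2 := norm_l1Normalize_le_one (WithLp.toLp 2 y)
  have h3 : 1 + 2 * √d * ‖(l1Norm (WithLp.toLp 2 y))⁻¹ • WithLp.toLp 2 y‖ ≤ 1 + 2 * √d := by
    have := mul_le_mul_of_nonneg_left h2 (show 0 ≤ 2 * √d by positivity)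
    linarith
  gcongr

/-- Differentiating in the direction of the gradient `v` itself gives `‖v‖² ≤ k ‖v‖` in the
Euclidean norm, although the domain carries the sup norm. -/
theorem sum_lineDeriv_sq_le_of_abs_sub_le {H : (Fin d → ℝ) → ℝ} {x : Fin d → ℝ} {k : ℝ}
    (hk : 0 ≤ k) (hx : DifferentiableAt ℝ H x)
    (h : ∀ y, |H y - H x| ≤ k * ‖WithLp.toLp 2 (y - x)‖) :
    ∑ i, lineDeriv ℝ H x (Pi.single i 1) ^ 2 ≤ k ^ 2 := by
  set v : Fin d → ℝ := fun i => lineDeriv ℝ H x (Pi.single i 1) with hv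
  have hvf : ∀ i, v i = fderiv ℝ H x (Pi.single i 1) := fun i => hx.lineDeriv_eq_fderiv
  have hD : fderiv ℝ H x v = ∑ i, v i ^ 2 := by
    conv_lhs => rw [pi_eq_sum_univ' v]
    simp [hvf, sq]
  have hn : ∑ i, v i ^ 2 = ‖WithLp.toLp 2 v‖ ^ 2 := by
    simp [EuclideanSpace.norm_sq_eq]
  have hle : |fderiv ℝ H x v| ≤ k * ‖WithLp.toLp 2 v‖ := by
    rw [← hx.lineDeriv_eq_fderiv, ← Real.norm_eq_abs, lineDeriv]
    refine norm_deriv_le_of_lip' (by positivity) (.of_forall fun t => ?_)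
    have := h (x + t • v)
    simp only [add_sub_cancel_left, WithLp.toLp_smul, norm_smul] at this
    simp only [zero_smul, add_zero, sub_zero, Real.norm_eq_abs] at this ⊢
    linarith
  rw [hD, abs_of_nonneg (Finset.sum_nonneg fun i _ => sq_nonneg _), hn] at hle
  change ∑ i, v i ^ 2 ≤ _
  rw [hn]
  have h0 := norm_nonneg (WithLp.toLp 2 v)
  have : ‖WithLp.toLp 2 v‖ ≤ k := by
    by_contra hc
    push Not at hc
    nlinarith
  exact pow_le_pow_left₀ h0 this 2

end

/-! ### Moments and the Poincaré-type inequality on the sphere. -/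

section

variable {d : ℕ} {C : ENNReal} {ν : Measure (EuclideanSpace ℝ (Fin d))} [IsProbabilityMeasure ν]

/-- The polar constant is read off from the test function `e^{-‖x‖₁}`, using that the Laplace
product has mass `1`. -/
theorem polar_const_mul_factorial (hd : 0 < d) (hν : ν (l1Sphere d)ᶜ = 0)
    (hvol : (volume : Measure (EuclideanSpace ℝ (Fin d))) =
      C • (ν.prod (radialMeasure d)).map fun p => p.2 • p.1) :
    C.toReal * (d - 1).factorial = 2 ^ d := by
  have h1 := integral_pi_laplaceMeasure (n := d) fun _ => 1
  have h2 := integral_l1Polar_mul hν hvol (G := fun x => Real.exp (-l1Norm x) * 1)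
    (by fun_prop) (fun _ => 1) (fun r => Real.exp (-r) * r ^ 0) (fun r θ hr hθ => by
      simp [l1Norm_smul, hθ, abs_of_pos hr])
  rw [integral_pow_mul_radial d 0 hd] at h2
  rw [h2] at h1
  simp only [integral_const, probReal_univ, smul_eq_mul, mul_one, one_mul, add_zero] at h1
  field_simp at h1
  linarith

theorem polar_const_mul_factorial_succ (hd : 0 < d) (hν : ν (l1Sphere d)ᶜ = 0)
    (hvol : (volume : Measure (EuclideanSpace ℝ (Fin d))) =
      C • (ν.prod (radialMeasure d)).map fun p => p.2 • p.1) :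
    C.toReal * (d + 1).factorial = 2 ^ d * (d * (d + 1)) := by
  rw [← polar_const_mul_factorial hd hν hvol]
  obtain ⟨n, rfl⟩ : ∃ n, d = n + 1 := ⟨d - 1, by omega⟩
  simp only [Nat.add_sub_cancel, Nat.factorial_succ]
  push_cast
  ring

/-- A Laplace vector has `E ‖X‖² = 2 d` and `E ‖X‖₁² = d (d + 1)`; by independence of radius and
direction the answer is the quotient. -/
theorem integral_norm_sq_uniform (hd : 0 < d) (hν : ν (l1Sphere d)ᶜ = 0)
    (hvol : (volume : Measure (EuclideanSpace ℝ (Fin d))) =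
      C • (ν.prod (radialMeasure d)).map fun p => p.2 • p.1) :
    ∫ θ, ‖θ‖ ^ 2 ∂ν = 2 / (d + 1) := by
  have h1 := integral_pi_laplaceMeasure (n := d) fun x => ‖x‖ ^ 2
  have h2 := integral_l1Polar_mul hν hvol (G := fun x => Real.exp (-l1Norm x) * ‖x‖ ^ 2)
    (by fun_prop) (fun θ => ‖θ‖ ^ 2) (fun r => Real.exp (-r) * r ^ 2) (fun r θ hr hθ => by
      simp only [l1Norm_smul, hθ, abs_of_pos hr, norm_smul, Real.norm_eq_abs]
      ring_nf)
  have h3 : ∫ x, ‖(WithLp.toLp 2 x : EuclideanSpace ℝ (Fin d))‖ ^ 2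
      ∂(Measure.pi fun _ : Fin d => laplaceMeasure) = 2 * d := by
    have hi : Integrable (fun x : ℝ => x ^ 2) laplaceMeasure :=
      memLp_two_id_laplaceMeasure.integrable_sq
    have hv : ∫ x : ℝ, x ^ 2 ∂laplaceMeasure = 2 := by
      simpa using integral_abs_pow_laplaceMeasure 2
    simp only [EuclideanSpace.norm_sq_eq, Real.norm_eq_abs, sq_abs]
    rw [integral_finsetSum _ fun i _ =>
      integrable_comp_eval (μ := fun _ : Fin d => laplaceMeasure) (f := fun x : ℝ => x ^ 2) hi]
    simp only [integral_comp_eval (μ := fun _ : Fin d => laplaceMeasure)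
      (f := fun x : ℝ => x ^ 2) hi.aestronglyMeasurable, hv]
    simp [mul_comm]
  rw [integral_pow_mul_radial d 2 hd, show d + 2 - 1 = d + 1 by omega] at h2
  rw [h3, h2] at h1
  have h4 := polar_const_mul_factorial_succ hd hν hvol
  have hd' : (0 : ℝ) < d := by exact_mod_cast hd
  have h5 : C.toReal * ((∫ θ, ‖θ‖ ^ 2 ∂ν) * (d + 1).factorial) =
      (∫ θ, ‖θ‖ ^ 2 ∂ν) * (C.toReal * (d + 1).factorial) := by ring
  rw [h5, h4] at h1
  field_simp at h1
  field_simp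
  linarith

/-- A Poincaré-type inequality for odd Lipschitz functions on the `ℓ₁`-sphere. -/
theorem integral_sq_le_of_odd_of_lipschitzWith (hd : 0 < d) (hν : ν (l1Sphere d)ᶜ = 0)
    (hvol : (volume : Measure (EuclideanSpace ℝ (Fin d))) =
      C • (ν.prod (radialMeasure d)).map fun p => p.2 • p.1)
    {F : EuclideanSpace ℝ (Fin d) → ℝ} (hF : LipschitzWith 1 F) (hodd : ∀ θ, F (-θ) = -F θ) :
    ∫ θ, F θ ^ 2 ∂ν ≤ 72 / d ^ 2 := by
  obtain ⟨K, hK⟩ := exists_lipschitzWith_l1Homogenize_toLp hF hodd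
  set μ := Measure.pi fun _ : Fin d => laplaceMeasure with hμ
  have hpoin := variance_pi_laplaceMeasure_le d hK
  rw [← hμ] at hpoin
  have hmean : ∫ x, l1Homogenize F (WithLp.toLp 2 x) ∂μ = 0 := by
    rw [integral_pi_laplaceMeasure]
    have h := integral_neg_eq_self (fun x => Real.exp (-l1Norm x) * l1Homogenize F x) volume
    have h2 : ∀ x, Real.exp (-l1Norm (-x)) * l1Homogenize F (-x) =
        -(Real.exp (-l1Norm x) * l1Homogenize F x) := fun x => by
      simp only [l1Homogenize, l1Norm_neg, smul_neg, hodd]; ring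
    simp only [h2, integral_neg] at h
    rw [show ∫ x, Real.exp (-l1Norm x) * l1Homogenize F x = 0 by linarith, mul_zero]
  rw [variance_of_integral_eq_zero hK.continuous.aemeasurable hmean] at hpoin
  have hGm := measurable_l1Homogenize hF
  have hlhs : ∫ x, l1Homogenize F (WithLp.toLp 2 x) ^ 2 ∂μ =
      d * (d + 1) * ∫ θ, F θ ^ 2 ∂ν := by
    rw [integral_pi_laplaceMeasure fun x => l1Homogenize F x ^ 2,
      integral_l1Polar_mul hν hvol (by fun_prop) (fun θ => F θ ^ 2)
        (fun r => Real.exp (-r) * r ^ 2) (fun r θ hr hθ => by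
          simp only [l1Homogenize, l1Norm_smul, hθ, abs_of_pos hr, mul_one, smul_smul,
            inv_mul_cancel₀ hr.ne', one_smul]
          ring),
      integral_pow_mul_radial d 2 hd, show d + 2 - 1 = d + 1 by omega]
    rw [mul_comm (∫ θ, F θ ^ 2 ∂ν), ← mul_assoc C.toReal,
      polar_const_mul_factorial_succ hd hν hvol]
    field_simp
  have hnm : Measurable fun x : EuclideanSpace ℝ (Fin d) => ‖(l1Norm x)⁻¹ • x‖ :=
    measurable_l1Normalize.norm
  -- With `a = 2 √d ‖θ‖`, the bound `(1 + a)² ≤ 2 + 2 a²` gives the integrand `2 + 8 d ‖θ‖²`.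
  have hrhs : ∫ x, ∑ i, lineDeriv ℝ (fun x : Fin d → ℝ => l1Homogenize F (WithLp.toLp 2 x)) x
      (Pi.single i 1) ^ 2 ∂μ ≤ 2 + 8 * d * (2 / (d + 1)) := by
    have hbound : ∫ x, ∑ i, lineDeriv ℝ
        (fun x : Fin d → ℝ => l1Homogenize F (WithLp.toLp 2 x)) x (Pi.single i 1) ^ 2 ∂μ ≤
        ∫ x : Fin d → ℝ, (fun x : EuclideanSpace ℝ (Fin d) =>
          2 + 8 * d * ‖(l1Norm x)⁻¹ • x‖ ^ 2) (WithLp.toLp 2 x) ∂μ := by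
      refine integral_mono_of_nonneg (.of_forall fun x => Finset.sum_nonneg fun i _ => sq_nonneg _)
        ?_ ?_
      · refine .of_bound (C := 2 + 8 * d) (Measurable.aestronglyMeasurable ?_)
          (.of_forall fun x => ?_)
        · have := hnm.comp (WithLp.measurable_toLp 2 (Fin d → ℝ))
          simp only [Function.comp_def] at this
          fun_prop
        · rw [Real.norm_of_nonneg (by positivity)]
          have h1 := pow_le_one₀ (n := 2) (norm_nonneg _)
            (norm_l1Normalize_le_one (WithLp.toLp 2 x))
          have := mul_le_mul_of_nonneg_left h1 (show 0 ≤ 8 * (d : ℝ) by positivity)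
          linarith
      -- Rademacher's theorem gives differentiability almost everywhere for Lebesgue measure, hence
      -- for the Laplace product.
      · filter_upwards [(pi_laplaceMeasure_absolutelyContinuous d).ae_le
          (hK.ae_differentiableAt (μ := volume))] with x hx
        refine (sum_lineDeriv_sq_le_of_abs_sub_le
          (k := 1 + 2 * √d * ‖(l1Norm (WithLp.toLp 2 x))⁻¹ • WithLp.toLp 2 x‖)
          (by positivity) hx fun y => ?_).trans ?_
        · rw [WithLp.toLp_sub]
          exact abs_l1Homogenize_sub_le hF hodd _ _
        · set n := ‖(l1Norm (WithLp.toLp 2 x))⁻¹ • WithLp.toLp 2 x‖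
          have hs : √(d : ℝ) ^ 2 = d := Real.sq_sqrt (Nat.cast_nonneg d)
          nlinarith [sq_nonneg (1 - 2 * √d * n)]
    refine hbound.trans (le_of_eq ?_)
    rw [integral_pi_laplaceMeasure (fun x => 2 + 8 * (d : ℝ) * ‖(l1Norm x)⁻¹ • x‖ ^ 2),
      integral_l1Polar_mul hν hvol (by fun_prop) (fun θ => 2 + 8 * d * ‖θ‖ ^ 2)
        (fun r => Real.exp (-r) * r ^ 0) (fun r θ hr hθ => by
          simp only [l1Norm_smul, hθ, abs_of_pos hr, mul_one, smul_smul,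
            inv_mul_cancel₀ hr.ne', one_smul]
          ring),
      integral_pow_mul_radial d 0 hd, add_zero]
    rw [mul_comm (∫ θ, (2 + 8 * (d : ℝ) * ‖θ‖ ^ 2) ∂ν), ← mul_assoc C.toReal,
      polar_const_mul_factorial hd hν hvol]
    have hi : Integrable (fun θ => 8 * (d : ℝ) * ‖θ‖ ^ 2) ν := by
      refine .of_bound (C := 8 * d) (by fun_prop) ?_
      filter_upwards [show ∀ᵐ θ ∂ν, θ ∈ l1Sphere d from hν] with θ hθ
      rw [Real.norm_of_nonneg (by positivity)]
      have h1 := pow_le_one₀ (n := 2) (norm_nonneg _)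
        ((norm_le_l1Norm θ).trans_eq (mem_l1Sphere.1 hθ))
      have := mul_le_mul_of_nonneg_left h1 (show 0 ≤ 8 * (d : ℝ) by positivity)
      linarith
    rw [integral_add (integrable_const _) hi, integral_const_mul,
      integral_norm_sq_uniform hd hν hvol]
    simp
  rw [hlhs] at hpoin
  have hd' : (0 : ℝ) < d := by exact_mod_cast hd
  have hfin := hpoin.trans (mul_le_mul_of_nonneg_left hrhs (by norm_num : (0 : ℝ) ≤ 4))
  have hI : (0 : ℝ) ≤ ∫ θ, F θ ^ 2 ∂ν := integral_nonneg fun θ => sq_nonneg _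
  -- The mean squared gradient is at most `2 + 16 = 18`, and `4 · 18 = 72`; then `d (d + 1) ≥ d²`.
  have h18 : (8 : ℝ) * d * (2 / (d + 1)) ≤ 16 := by
    rw [mul_div_assoc', div_le_iff₀ (by positivity)]
    linarith
  rw [le_div_iff₀ (by positivity)]
  nlinarith
end

/-! ### The divergence formula for the `ℓ₁`-ball, by translating the ball. -/

/-- The indicator function of the open unit `ℓ₁`-ball. -/
noncomputable def l1BallIndicator {d : ℕ} (u : EuclideanSpace ℝ (Fin d)) : ℝ :=
  if l1Norm u < 1 then 1 else 0

section

variable {d : ℕ}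

@[fun_prop]
theorem measurable_l1BallIndicator :
    Measurable (l1BallIndicator : EuclideanSpace ℝ (Fin d) → ℝ) :=
  Measurable.ite (measurableSet_lt continuous_l1Norm.measurable measurable_const)
    measurable_const measurable_const

theorem l1BallIndicator_nonneg (u : EuclideanSpace ℝ (Fin d)) : 0 ≤ l1BallIndicator u := by
  unfold l1BallIndicator; split_ifs <;> norm_num

theorem l1BallIndicator_le_one (u : EuclideanSpace ℝ (Fin d)) : l1BallIndicator u ≤ 1 := by
  unfold l1BallIndicator; split_ifs <;> norm_num

theorem abs_l1BallIndicator_sub_le (u v : EuclideanSpace ℝ (Fin d)) :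
    |l1BallIndicator u - l1BallIndicator v| ≤ 1 := by
  unfold l1BallIndicator; split_ifs <;> norm_num

theorem exists_bound_of_l1Norm_le_two {g : EuclideanSpace ℝ (Fin d) → ℝ} (hg : Continuous g) :
    ∃ M, 0 ≤ M ∧ ∀ u, l1Norm u ≤ 2 → |g u| ≤ M := by
  obtain ⟨M, hM⟩ := (isCompact_closedBall (0 : EuclideanSpace ℝ (Fin d)) 2).exists_bound_of_continuousOn
    hg.continuousOn
  refine ⟨max M 0, le_max_right _ _, fun u hu => (hM u ?_).trans (le_max_left _ _)⟩
  exact mem_closedBall_zero_iff.2 ((norm_le_l1Norm u).trans hu)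

theorem integrable_mul_of_l1Norm_support {g m : EuclideanSpace ℝ (Fin d) → ℝ} (hg : Continuous g)
    (hm : Measurable m) (hm1 : ∀ u, |m u| ≤ 1) (hm2 : ∀ u, 2 < l1Norm u → m u = 0) :
    Integrable fun u => m u * g u := by
  obtain ⟨M, hM0, hM⟩ := exists_bound_of_l1Norm_le_two hg
  have hi : Integrable ((Metric.closedBall (0 : EuclideanSpace ℝ (Fin d)) 2).indicator
      fun _ => M) :=
    (integrable_indicator_iff measurableSet_closedBall).2
      (integrableOn_const measure_closedBall_lt_top.ne)
  refine hi.mono' (hm.mul hg.measurable).aestronglyMeasurable (.of_forall fun u => ?_)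
  by_cases hu : l1Norm u ≤ 2
  · rw [Set.indicator_of_mem (mem_closedBall_zero_iff.2 ((norm_le_l1Norm u).trans hu)), norm_mul,
      Real.norm_eq_abs, Real.norm_eq_abs]
    nlinarith [hm1 u, hM u hu, abs_nonneg (m u), abs_nonneg (g u)]
  · rw [hm2 u (not_le.1 hu)]
    simp only [zero_mul, norm_zero]
    exact Set.indicator_nonneg (fun _ _ => hM0) _

theorem integrable_l1BallIndicator_mul {g : EuclideanSpace ℝ (Fin d) → ℝ} (hg : Continuous g) :
    Integrable fun u => l1BallIndicator u * g u := by
  refine integrable_mul_of_l1Norm_support hg measurable_l1BallIndicator (fun u => ?_) fun u hu => ?_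
  · rw [abs_of_nonneg (l1BallIndicator_nonneg u)]; exact l1BallIndicator_le_one u
  · rw [l1BallIndicator, if_neg (by linarith)]

theorem abs_inner_signVec_le (θ w : EuclideanSpace ℝ (Fin d)) :
    |inner ℝ (signVec θ) w| ≤ l1Norm w := by
  simp only [signVec, PiLp.inner_apply, l1Norm]
  refine (Finset.abs_sum_le_sum_abs _ _).trans (Finset.sum_le_sum fun i _ => ?_)
  split_ifs <;> simp

theorem norm_signVec_sq (θ : EuclideanSpace ℝ (Fin d)) : ‖signVec θ‖ ^ 2 = d := by
  rw [EuclideanSpace.norm_sq_eq]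
  have : ∀ i, ‖signVec θ i‖ ^ 2 = 1 := fun i => by
    simp only [signVec]; split_ifs <;> simp
  rw [Finset.sum_congr rfl fun i _ => this i]
  simp

@[fun_prop]
theorem measurable_signVec :
    Measurable (signVec : EuclideanSpace ℝ (Fin d) → EuclideanSpace ℝ (Fin d)) := by
  unfold signVec
  refine (WithLp.measurable_toLp 2 _).comp (measurable_pi_lambda _ fun i => ?_)
  exact Measurable.ite (measurableSet_le measurable_const (by fun_prop))
    measurable_const measurable_const

/-- The displacement is too small to change the sign of any coordinate, so the `ℓ₁`-norm is affine
along it with slope `signVec θ`. -/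
theorem l1Norm_add_smul_of_small {θ w : EuclideanSpace ℝ (Fin d)} {r s : ℝ}
    (hθ : l1Norm θ = 1) (hr : 1 / 2 ≤ r) (hs : 0 ≤ s) (h : ∀ i, s * |w i| < 1 / 2 * |θ i|) :
    l1Norm (r • θ + s • w) = r + s * inner ℝ (signVec θ) w := by
  have hi : ∀ i, |(r • θ + s • w) i| = r * |θ i| + s * (inner ℝ (signVec θ i) (w i)) := by
    intro i
    have h1 : 1 / 2 * |θ i| ≤ r * |θ i| := by gcongr
    have h2 := h i
    have h3 := mul_le_mul_of_nonneg_left (le_abs_self (w i)) hs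
    have h4 := mul_le_mul_of_nonneg_left (neg_abs_le (w i)) hs
    simp only [PiLp.add_apply, PiLp.smul_apply, smul_eq_mul, signVec]
    split_ifs with h0
    · rw [abs_of_nonneg h0] at *
      rw [abs_of_nonneg (by linarith)]
      simp
    · rw [abs_of_neg (not_le.1 h0)] at *
      rw [abs_of_nonpos (by linarith)]
      simp
      ring
  rw [l1Norm, Finset.sum_congr rfl fun i _ => hi i, Finset.sum_add_distrib, ← Finset.mul_sum,
    ← Finset.mul_sum, PiLp.inner_apply]
  change r * l1Norm θ + _ = _
  rw [hθ, mul_one]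

/-- For `r ≥ 1 / 2` the norm of the shifted point is affine in `s`; for `r < 1 / 2` all four
indicators equal `1`. -/
theorem l1BallIndicator_polar_sub {θ w : EuclideanSpace ℝ (Fin d)} {r s : ℝ}
    (hθ : l1Norm θ = 1) (hr : 0 < r) (hs : 0 ≤ s) (hw : s * l1Norm w < 1 / 2)
    (h : ∀ i, s * |w i| < 1 / 2 * |θ i|) :
    l1BallIndicator (r • θ) - l1BallIndicator (r • θ + s • w) =
      (if r < 1 then 1 else 0) - if r < 1 - s * inner ℝ (signVec θ) w then 1 else 0 := by
  have hn : l1Norm (r • θ) = r := by rw [l1Norm_smul, hθ, abs_of_pos hr, mul_one]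
  have hb : |s * inner ℝ (signVec θ) w| < 1 / 2 := by
    rw [abs_mul, abs_of_nonneg hs]
    exact (mul_le_mul_of_nonneg_left (abs_inner_signVec_le θ w) hs).trans_lt hw
  rw [abs_lt] at hb
  rcases le_or_gt (1 / 2) r with hr2 | hr2
  · simp only [l1BallIndicator, hn, l1Norm_add_smul_of_small hθ hr2 hs h, lt_sub_iff_add_lt]
  · have h1 : l1Norm (r • θ + s • w) < 1 := by
      refine (l1Norm_add_le _ _).trans_lt ?_
      rw [hn, l1Norm_smul, abs_of_nonneg hs]
      linarith
    simp only [l1BallIndicator, hn, h1, if_true]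
    rw [if_pos (by linarith), if_pos (by linarith)]

theorem setIntegral_Ioi_mul_ite_lt {k : ℝ → ℝ} {y : ℝ} (hy : 0 ≤ y) :
    ∫ r in Set.Ioi 0, k r * (if r < y then 1 else 0) = ∫ r in 0..y, k r := by
  rw [intervalIntegral.integral_of_le hy, integral_Ioc_eq_integral_Ioo, ← Set.Ioi_inter_Iio,
    ← setIntegral_indicator measurableSet_Iio]
  refine integral_congr_ae (.of_forall fun r => ?_)
  simp [Set.indicator_apply]

theorem integrableOn_Ioi_mul_ite_lt {k : ℝ → ℝ} (hk : Continuous k) (y : ℝ) :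
    IntegrableOn (fun r => k r * (if r < y then 1 else 0)) (Set.Ioi 0) := by
  have h : IntegrableOn k (Set.Ioi 0 ∩ Set.Iio y) :=
    (hk.integrableOn_Icc (a := 0) (b := y)).mono_set fun r hr => ⟨le_of_lt hr.1, le_of_lt hr.2⟩
  have h2 := (integrableOn_indicator_iff (μ := volume) (s := Set.Iio y) (t := Set.Ioi 0)
    (f := k) measurableSet_Iio).2 (by rwa [Set.inter_comm])
  refine h2.congr (.of_forall fun r => ?_)
  simp [Set.indicator_apply]

/-- On the ray through `θ`, shifting the ball moves its boundary from radius `1` to `1 - s b`. The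
limit is a derivative of the radial integral at its endpoint, where `r ^ (d - 1) = 1`. -/
theorem tendsto_inv_mul_integral_polar {g : EuclideanSpace ℝ (Fin d) → ℝ} (hg : Continuous g)
    {θ w : EuclideanSpace ℝ (Fin d)} (hθ : l1Norm θ = 1) (hθ0 : ∀ i, θ i ≠ 0) :
    Filter.Tendsto (fun s : ℝ => s⁻¹ * ∫ r in Set.Ioi 0, r ^ (d - 1) *
      ((l1BallIndicator (r • θ) - l1BallIndicator (r • θ + s • w)) * g (r • θ)))
      (nhdsWithin 0 (Set.Ioi 0)) (nhds (g θ * inner ℝ (signVec θ) w)) := by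
  set b := inner ℝ (signVec θ) w with hb
  set k : ℝ → ℝ := fun r => r ^ (d - 1) * g (r • θ) with hk
  have hkc : Continuous k := by fun_prop
  have hder : HasDerivAt (fun s : ℝ => ∫ r in (0 : ℝ)..(1 - s * b), k r) (-(k 1 * b)) 0 := by
    have h1 : HasDerivAt (fun y : ℝ => ∫ r in (0 : ℝ)..y, k r) (k 1) (1 - 0 * b) := by
      simpa using intervalIntegral.integral_hasDerivAt_right (hkc.intervalIntegrable 0 1)
        hkc.aestronglyMeasurable.stronglyMeasurableAtFilter hkc.continuousAt
    have h2 : HasDerivAt (fun s : ℝ => 1 - s * b) (-b) 0 := by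
      simpa using ((hasDerivAt_id (0 : ℝ)).mul_const b).const_sub 1
    convert! h1.comp (0 : ℝ) h2 using 1
    ring
  have hlim := hder.tendsto_slope_zero_right.neg
  have hk1 : k 1 = g θ := by simp [hk]
  rw [neg_neg, hk1] at hlim
  refine hlim.congr' ?_
  have hsmall : ∀ c δ : ℝ, 0 < δ → ∀ᶠ s in nhdsWithin (0 : ℝ) (Set.Ioi 0), s * c < δ := by
    intro c δ hδ
    have : Filter.Tendsto (fun s : ℝ => s * c) (nhds 0) (nhds 0) := by
      simpa using (continuous_id.mul continuous_const).tendsto (x := (0 : ℝ)) (f := fun s : ℝ => s * c)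
    exact (this.mono_left nhdsWithin_le_nhds).eventually_lt_const hδ
  filter_upwards [self_mem_nhdsWithin, hsmall (l1Norm w) (1 / 2) (by norm_num),
    Filter.eventually_all.2 fun i => hsmall |w i| (1 / 2 * |θ i|)
      (by have := abs_pos.2 (hθ0 i); positivity)] with s hs h1 h2
  have hs : 0 < s := hs
  have hb2 : |s * b| < 1 / 2 := by
    rw [abs_mul, abs_of_pos hs]
    exact (mul_le_mul_of_nonneg_left (abs_inner_signVec_le θ w) hs.le).trans_lt h1
  rw [abs_lt] at hb2
  have e : ∫ r in Set.Ioi 0, r ^ (d - 1) *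
      ((l1BallIndicator (r • θ) - l1BallIndicator (r • θ + s • w)) * g (r • θ)) =
      (∫ r in (0 : ℝ)..1, k r) - ∫ r in (0 : ℝ)..(1 - s * b), k r := by
    rw [← setIntegral_Ioi_mul_ite_lt zero_le_one,
      ← setIntegral_Ioi_mul_ite_lt (show 0 ≤ 1 - s * b by linarith),
      ← integral_sub (integrableOn_Ioi_mul_ite_lt hkc _) (integrableOn_Ioi_mul_ite_lt hkc _)]
    refine setIntegral_congr_fun measurableSet_Ioi fun r hr => ?_
    simp only [l1BallIndicator_polar_sub hθ hr hs.le h1 h2, hk, ← hb]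
    ring
  rw [e]
  simp
  ring

end

section

variable {d : ℕ} {C : ENNReal} {ν : Measure (EuclideanSpace ℝ (Fin d))}

theorem ae_apply_ne_zero (hd : 0 < d)
    (hC : C ≠ 0)
    (hvol : (volume : Measure (EuclideanSpace ℝ (Fin d))) =
      C • (ν.prod (radialMeasure d)).map fun p => p.2 • p.1) :
    ∀ᵐ θ ∂ν, ∀ i, θ i ≠ 0 := by
  refine ae_all_iff.2 fun i => ?_
  have hm : Measurable fun p : EuclideanSpace ℝ (Fin d) × ℝ => p.2 • p.1 := by fun_prop
  have hms : MeasurableSet {x : EuclideanSpace ℝ (Fin d) | x i = 0} :=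
    measurableSet_eq_fun (by fun_prop) measurable_const
  have h0 : volume {x : EuclideanSpace ℝ (Fin d) | x i = 0} = 0 := by
    set W : Submodule ℝ (EuclideanSpace ℝ (Fin d)) :=
      LinearMap.ker (EuclideanSpace.proj i : EuclideanSpace ℝ (Fin d) →L[ℝ] ℝ).toLinearMap with hW
    have hne : W ≠ ⊤ := by
      intro h
      have : EuclideanSpace.single i (1 : ℝ) ∈ W := h ▸ Submodule.mem_top
      simp [hW] at this
    exact Measure.addHaar_submodule volume W hne
  rw [hvol, Measure.smul_apply, smul_eq_mul, mul_eq_zero, or_iff_right hC,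
    Measure.map_apply hm hms] at h0
  have h1 : (ν.prod (radialMeasure d)) ({θ | θ i = 0} ×ˢ Set.univ) = 0 := by
    refine measure_mono_null ?_ h0
    rintro ⟨θ, r⟩ ⟨hθ, -⟩
    have hθ : θ i = 0 := hθ
    simp [hθ]
  rw [Measure.prod_prod, mul_eq_zero] at h1
  rcases h1 with h1 | h1
  · exact compl_mem_ae_iff.2 h1
  · exfalso
    have h2 := radialMeasure_Iio_one hd
    rw [measure_mono_null (Set.subset_univ _) h1] at h2
    have : (0 : ENNReal) < ENNReal.ofReal (1 / d) := by
      rw [ENNReal.ofReal_pos]; positivity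
    exact this.ne h2

theorem integrable_comp_l1Polar (hC : C ≠ 0) (hC' : C ≠ ⊤)
    (hvol : (volume : Measure (EuclideanSpace ℝ (Fin d))) =
      C • (ν.prod (radialMeasure d)).map fun p => p.2 • p.1)
    {G : EuclideanSpace ℝ (Fin d) → ℝ} (hGm : Measurable G) (hG : Integrable G) :
    Integrable (fun p : EuclideanSpace ℝ (Fin d) × ℝ => G (p.2 • p.1))
      (ν.prod (radialMeasure d)) := by
  rw [hvol, integrable_smul_measure hC hC'] at hG
  exact (integrable_map_measure hGm.aestronglyMeasurable (by fun_prop)).1 hG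

theorem tendsto_inv_mul_integral_l1BallIndicator_sub [IsProbabilityMeasure ν] (hd : 0 < d)
    (hC : C ≠ 0) (hC' : C ≠ ⊤) (hν : ν (l1Sphere d)ᶜ = 0)
    (hvol : (volume : Measure (EuclideanSpace ℝ (Fin d))) =
      C • (ν.prod (radialMeasure d)).map fun p => p.2 • p.1)
    {g : EuclideanSpace ℝ (Fin d) → ℝ} (hg : Continuous g) (w : EuclideanSpace ℝ (Fin d)) :
    Filter.Tendsto (fun s : ℝ => s⁻¹ *
        ∫ u, (l1BallIndicator u - l1BallIndicator (u + s • w)) * g u)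
      (nhdsWithin 0 (Set.Ioi 0))
      (nhds (C.toReal * ∫ θ, g θ * inner ℝ (signVec θ) w ∂ν)) := by
  obtain ⟨M, hM0, hM⟩ := exists_bound_of_l1Norm_le_two hg
  have hsw : ∀ᶠ s in nhdsWithin (0 : ℝ) (Set.Ioi 0), s * l1Norm w < 1 / 2 := by
    have : Filter.Tendsto (fun s : ℝ => s * l1Norm w) (nhds 0) (nhds 0) := by
      simpa using (continuous_id.mul continuous_const).tendsto (x := (0 : ℝ))
        (f := fun s : ℝ => s * l1Norm w)
    exact (this.mono_left nhdsWithin_le_nhds).eventually_lt_const (by norm_num)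
  set K : ℝ → EuclideanSpace ℝ (Fin d) → ℝ :=
    fun s u => (l1BallIndicator u - l1BallIndicator (u + s • w)) * g u with hK
  have hKm : ∀ s, Measurable (K s) := fun s => by
    have : Measurable g := hg.measurable
    have h2 : Measurable fun u : EuclideanSpace ℝ (Fin d) => l1BallIndicator (u + s • w) :=
      measurable_l1BallIndicator.comp (measurable_id.add_const _)
    exact (measurable_l1BallIndicator.sub h2).mul this
  have hzero : ∀ s, 0 < s → s * l1Norm w < 1 / 2 → ∀ u, s * l1Norm w < |l1Norm u - 1| →
      l1BallIndicator u - l1BallIndicator (u + s • w) = 0 := by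
    intro s hs h1 u hu
    have h2 : |l1Norm (u + s • w) - l1Norm u| ≤ s * l1Norm w := by
      refine (abs_l1Norm_sub_le _ _).trans_eq ?_
      rw [add_sub_cancel_left, l1Norm_smul, abs_of_pos hs]
    rw [abs_le] at h2
    unfold l1BallIndicator
    rcases lt_abs.1 hu with h3 | h3
    · rw [if_neg (by linarith), if_neg (by linarith), sub_zero]
    · have hnn := mul_nonneg hs.le (l1Norm_nonneg w)
      rw [if_pos (by linarith), if_pos (by linarith), sub_self]
  have hKi : ∀ s, 0 < s → s * l1Norm w < 1 / 2 → Integrable (K s) := by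
    intro s hs h1
    have h2 : Measurable fun u : EuclideanSpace ℝ (Fin d) => l1BallIndicator (u + s • w) :=
      measurable_l1BallIndicator.comp (measurable_id.add_const _)
    refine integrable_mul_of_l1Norm_support hg (measurable_l1BallIndicator.sub h2)
      (fun u => abs_l1BallIndicator_sub_le _ _) fun u hu => hzero s hs h1 u ?_
    rw [abs_of_pos (by linarith)]
    linarith
  have hpolar : ∀ s, 0 < s → s * l1Norm w < 1 / 2 → ∫ u, K s u =
      C.toReal * ∫ θ, (∫ r in Set.Ioi 0, r ^ (d - 1) * K s (r • θ)) ∂ν := by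
    intro s hs h1
    rw [integral_l1Polar hvol (hKm s),
      integral_prod _ (integrable_comp_l1Polar hC hC' hvol (hKm s) (hKi s hs h1))]
    simp only [integral_radialMeasure]
  have hdct : Filter.Tendsto
      (fun s => ∫ θ, s⁻¹ * (∫ r in Set.Ioi 0, r ^ (d - 1) * K s (r • θ)) ∂ν)
      (nhdsWithin 0 (Set.Ioi 0)) (nhds (∫ θ, g θ * inner ℝ (signVec θ) w ∂ν)) := by
    -- The radial integrand vanishes outside the shell `|r - 1| ≤ s ‖w‖₁`, of width `2 s ‖w‖₁`.
    -- There `r ≤ 2` and `|g| ≤ M`, so the bound survives division by `s`.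
    refine tendsto_integral_filter_of_dominated_convergence
      (fun _ => 2 ^ (d - 1) * M * (2 * l1Norm w)) ?_ ?_ (integrable_const _) ?_
    · filter_upwards [self_mem_nhdsWithin, hsw] with s hs h1
      have h2 := (integrable_comp_l1Polar hC hC' hvol (hKm s) (hKi s hs h1)).integral_prod_left
      simp only [integral_radialMeasure] at h2
      exact h2.aestronglyMeasurable.const_mul _
    · filter_upwards [self_mem_nhdsWithin, hsw] with s hs h1
      have hs : 0 < s := hs
      filter_upwards [show ∀ᵐ θ ∂ν, θ ∈ l1Sphere d from hν] with θ hθ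
      have hθ : l1Norm θ = 1 := hθ
      set a := s * l1Norm w with ha
      have ha0 : 0 ≤ a := mul_nonneg hs.le (l1Norm_nonneg w)
      have hpt : ∀ r ∈ Set.Ioi (0 : ℝ), ‖r ^ (d - 1) * K s (r • θ)‖ ≤
          (Set.Icc (1 - a) (1 + a)).indicator (fun _ => 2 ^ (d - 1) * M) r := by
        intro r hr
        have hr : 0 < r := hr
        have hn : l1Norm (r • θ) = r := by rw [l1Norm_smul, hθ, abs_of_pos hr, mul_one]
        by_cases hra : |r - 1| ≤ a
        · have hra' := abs_le.1 hra
          rw [Set.indicator_of_mem (Set.mem_Icc.2 ⟨by linarith, by linarith⟩), norm_mul, norm_pow,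
            Real.norm_of_nonneg hr.le, Real.norm_eq_abs, abs_mul]
          have h2 : r ^ (d - 1) ≤ 2 ^ (d - 1) := pow_le_pow_left₀ hr.le (by linarith) _
          have h3 := hM (r • θ) (by rw [hn]; linarith)
          have h4 := abs_l1BallIndicator_sub_le (r • θ) (r • θ + s • w)
          have h5 : |l1BallIndicator (r • θ) - l1BallIndicator (r • θ + s • w)| * |g (r • θ)| ≤
              1 * M := by gcongr
          rw [one_mul] at h5
          gcongr
        · simp only [hK]
          rw [hzero s hs h1 _ (by rw [hn]; exact not_le.1 hra)]
          simp only [zero_mul, mul_zero, norm_zero]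
          exact Set.indicator_nonneg (fun _ _ => by positivity) _
      have hint : Integrable ((Set.Icc (1 - a) (1 + a)).indicator
          fun _ => (2 : ℝ) ^ (d - 1) * M) :=
        (integrable_indicator_iff measurableSet_Icc).2 (integrableOn_const (by simp))
      have hle : ‖∫ r in Set.Ioi 0, r ^ (d - 1) * K s (r • θ)‖ ≤ 2 ^ (d - 1) * M * (2 * a) := by
        calc ‖∫ r in Set.Ioi 0, r ^ (d - 1) * K s (r • θ)‖
            ≤ ∫ r in Set.Ioi 0, (Set.Icc (1 - a) (1 + a)).indicator
                (fun _ => (2 : ℝ) ^ (d - 1) * M) r := by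
              refine norm_integral_le_of_norm_le hint.integrableOn ?_
              exact (ae_restrict_mem measurableSet_Ioi).mono hpt
          _ ≤ ∫ r, (Set.Icc (1 - a) (1 + a)).indicator (fun _ => (2 : ℝ) ^ (d - 1) * M) r :=
              setIntegral_le_integral hint
                (.of_forall fun r => Set.indicator_nonneg (fun _ _ => by positivity) _)
          _ = 2 ^ (d - 1) * M * (2 * a) := by
              rw [integral_indicator measurableSet_Icc, setIntegral_const, smul_eq_mul,
                Real.volume_real_Icc_of_le (by linarith)]
              ring
      rw [norm_mul, norm_inv, Real.norm_of_nonneg hs.le, inv_mul_le_iff₀ hs]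
      refine hle.trans_eq ?_
      rw [ha]; ring
    · filter_upwards [show ∀ᵐ θ ∂ν, θ ∈ l1Sphere d from hν, ae_apply_ne_zero hd hC hvol]
        with θ hθ hθ0
      exact tendsto_inv_mul_integral_polar hg hθ hθ0
  refine (hdct.const_mul C.toReal).congr' ?_
  filter_upwards [self_mem_nhdsWithin, hsw] with s hs h1
  rw [hpolar s hs h1, integral_const_mul]
  ring

end

/-! ### Smoothing over the `ℓ₁`-ball: bias and convexity. -/

section

variable {d : ℕ} {C : ENNReal} {ν : Measure (EuclideanSpace ℝ (Fin d))} [IsProbabilityMeasure ν]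

theorem integral_l1BallIndicator (hd : 0 < d) (hν : ν (l1Sphere d)ᶜ = 0)
    (hvol : (volume : Measure (EuclideanSpace ℝ (Fin d))) =
      C • (ν.prod (radialMeasure d)).map fun p => p.2 • p.1) :
    ∫ u : EuclideanSpace ℝ (Fin d), l1BallIndicator u = C.toReal / d := by
  rw [integral_l1Polar_mul hν hvol measurable_l1BallIndicator (fun _ => 1)
    (fun r => if r < 1 then 1 else 0) (fun r θ hr hθ => by
      simp [l1BallIndicator, l1Norm_smul, hθ, abs_of_pos hr]),
    setIntegral_Ioi_mul_ite_lt zero_le_one, integral_pow]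
  have : ((d - 1 : ℕ) : ℝ) + 1 = d := by exact_mod_cast Nat.sub_add_cancel hd
  simp [this, Nat.sub_add_cancel hd, div_eq_mul_inv, hd.ne']

theorem integral_norm_uniform_le (hd : 0 < d) (hν : ν (l1Sphere d)ᶜ = 0)
    (hvol : (volume : Measure (EuclideanSpace ℝ (Fin d))) =
      C • (ν.prod (radialMeasure d)).map fun p => p.2 • p.1) :
    ∫ θ, ‖θ‖ ∂ν ≤ √(2 / (d + 1)) := by
  have hm : MemLp (fun θ : EuclideanSpace ℝ (Fin d) => ‖θ‖) 2 ν := by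
    refine .of_bound (by fun_prop) 1 ?_
    filter_upwards [show ∀ᵐ θ ∂ν, θ ∈ l1Sphere d from hν] with θ hθ
    rw [norm_norm]
    exact (norm_le_l1Norm θ).trans_eq hθ
  refine Real.le_sqrt_of_sq_le ?_
  rw [← integral_norm_sq_uniform hd hν hvol]
  exact sq_integral_le_integral_sq hm

/-- The radial integral gives `1 / (d + 1)`, which is relaxed to `1 / d` so that the volume `C / d`
of the ball factors out. -/
theorem integral_l1BallIndicator_mul_norm_le (hd : 0 < d) (hν : ν (l1Sphere d)ᶜ = 0)
    (hvol : (volume : Measure (EuclideanSpace ℝ (Fin d))) =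
      C • (ν.prod (radialMeasure d)).map fun p => p.2 • p.1) :
    ∫ u : EuclideanSpace ℝ (Fin d), l1BallIndicator u * ‖u‖ ≤
      C.toReal / d * √(2 / (d + 1)) := by
  rw [integral_l1Polar_mul hν hvol (G := fun u => l1BallIndicator u * ‖u‖) (by fun_prop)
    (fun θ => ‖θ‖) (fun r => r * if r < 1 then 1 else 0) (fun r θ hr hθ => by
      simp only [l1BallIndicator, l1Norm_smul, hθ, abs_of_pos hr, norm_smul,
        Real.norm_of_nonneg hr.le, mul_one]
      ring)]
  simp only [← mul_assoc, ← pow_succ, Nat.sub_add_cancel hd]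
  rw [setIntegral_Ioi_mul_ite_lt zero_le_one, integral_pow]
  have h1 := integral_norm_uniform_le hd hν hvol
  have hd' : (0 : ℝ) < d := by exact_mod_cast hd
  have h2 : (1 : ℝ) / (d + 1) ≤ 1 / d := one_div_le_one_div_of_le hd' (by linarith)
  have h3 : (0 : ℝ) ≤ ∫ θ, ‖θ‖ ∂ν := integral_nonneg fun θ => norm_nonneg _
  simp only [one_pow, zero_pow (Nat.succ_ne_zero d), sub_zero]
  calc (C.toReal * ∫ θ, ‖θ‖ ∂ν) * (1 / ((d : ℝ) + 1))
      ≤ C.toReal * √(2 / (d + 1)) * (1 / d) := by gcongr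
    _ = _ := by ring

theorem abs_integral_l1BallIndicator_mul_sub_le (hd : 0 < d) (hν : ν (l1Sphere d)ᶜ = 0)
    (hvol : (volume : Measure (EuclideanSpace ℝ (Fin d))) =
      C • (ν.prod (radialMeasure d)).map fun p => p.2 • p.1)
    {f : EuclideanSpace ℝ (Fin d) → ℝ} {L : ℝ} (hfc : Continuous f) (hL : 0 ≤ L)
    (hf : ∀ u v, |f u - f v| ≤ L * ‖u - v‖) {h : ℝ} (hh : 0 < h)
    (y : EuclideanSpace ℝ (Fin d)) :
    |(∫ u, l1BallIndicator u * f (y + h • u)) - C.toReal / d * f y| ≤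
      C.toReal / d * (L * h * √(2 / (d + 1))) := by
  rw [← integral_l1BallIndicator hd hν hvol, ← integral_mul_const, ← integral_sub
    (integrable_l1BallIndicator_mul (by fun_prop)) (integrable_l1BallIndicator_mul (by fun_prop))]
  rw [integral_l1BallIndicator hd hν hvol]
  calc |∫ u, (l1BallIndicator u * f (y + h • u) - l1BallIndicator u * f y)|
      ≤ ∫ u, L * h * (l1BallIndicator u * ‖u‖) := by
        rw [← Real.norm_eq_abs]
        refine norm_integral_le_of_norm_le
          ((integrable_l1BallIndicator_mul continuous_norm).const_mul _) (.of_forall fun u => ?_)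
        have h1 := hf (y + h • u) y
        rw [add_sub_cancel_left, norm_smul, Real.norm_of_nonneg hh.le] at h1
        rw [← mul_sub, norm_mul, Real.norm_of_nonneg (l1BallIndicator_nonneg u), Real.norm_eq_abs]
        have := mul_le_mul_of_nonneg_left h1 (l1BallIndicator_nonneg u)
        linarith
    _ = L * h * ∫ u, l1BallIndicator u * ‖u‖ := integral_const_mul _ _
    _ ≤ L * h * (C.toReal / d * √(2 / (d + 1))) := by
        gcongr
        exact integral_l1BallIndicator_mul_norm_le hd hν hvol
    _ = _ := by ring

theorem ConvexOn.sub_le_inv_mul_sub {E : Type*} [AddCommGroup E] [Module ℝ E] {f : E → ℝ}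
    (hf : ConvexOn ℝ Set.univ f) (y w : E) {t : ℝ} (ht : 0 < t) (ht1 : t ≤ 1) :
    f y - f (y - w) ≤ t⁻¹ * (f y - f (y - t • w)) := by
  have h := hf.2 (Set.mem_univ y) (Set.mem_univ (y - w)) (sub_nonneg.2 ht1) ht.le (by ring)
  have e : (1 - t) • y + t • (y - w) = y - t • w := by module
  rw [e] at h
  simp only [smul_eq_mul] at h
  rw [le_inv_mul_iff₀ ht]
  linarith

/-- The smoothed function `y ↦ ∫ f (y + h u) du` over the `ℓ₁`-ball lies above its linear
approximation, whose slope is a surface integral. -/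
theorem integral_l1Ball_sub_le (hd : 0 < d)
    (hC : C ≠ 0) (hC' : C ≠ ⊤) (hν : ν (l1Sphere d)ᶜ = 0)
    (hvol : (volume : Measure (EuclideanSpace ℝ (Fin d))) =
      C • (ν.prod (radialMeasure d)).map fun p => p.2 • p.1)
    {f : EuclideanSpace ℝ (Fin d) → ℝ} (hfc : Continuous f) (hf : ConvexOn ℝ Set.univ f)
    {h : ℝ} (hh : 0 < h) (x w : EuclideanSpace ℝ (Fin d)) :
    (∫ u, l1BallIndicator u * f (x + h • u)) - (∫ u, l1BallIndicator u * f (x - w + h • u)) ≤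
      h⁻¹ * (C.toReal * ∫ θ, f (x + h • θ) * inner ℝ (signVec θ) w ∂ν) := by
  have hint : ∀ y, Integrable fun u => l1BallIndicator u * f (y + h • u) := fun y =>
    integrable_l1BallIndicator_mul (by fun_prop)
  have hlim := (tendsto_inv_mul_integral_l1BallIndicator_sub hd hC hC' hν hvol
    (g := fun u => f (x + h • u)) (by fun_prop) w).const_mul h⁻¹
  -- By convexity the full increment along `w` is at most the difference quotient for the step `t =
  -- s h`. This holds for all small `s`, so it passes to the limit.
  refine ge_of_tendsto hlim ?_
  have hsmall : ∀ᶠ s in nhdsWithin (0 : ℝ) (Set.Ioi 0), s < h⁻¹ :=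
    (Filter.tendsto_id.mono_left nhdsWithin_le_nhds).eventually_lt_const (inv_pos.2 hh)
  filter_upwards [self_mem_nhdsWithin, hsmall] with s hs hs1
  have hs : 0 < s := hs
  have ht : 0 < s * h := mul_pos hs hh
  have ht1 : s * h ≤ 1 := by
    have := mul_le_mul_of_nonneg_right hs1.le hh.le
    rwa [inv_mul_cancel₀ hh.ne'] at this
  -- Translating `u` by `s • w` moves the displacement from `f` to the ball, which is what makes the
  -- shifted-ball limit applicable.
  have htrans : ∫ u, l1BallIndicator u * f (x - (s * h) • w + h • u) =
      ∫ u, l1BallIndicator (u + s • w) * f (x + h • u) := by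
    rw [← integral_add_right_eq_self _ (s • w)]
    refine integral_congr_ae (.of_forall fun u => ?_)
    simp only []
    congr 2
    module
  have hint2 : Integrable fun u => l1BallIndicator (u + s • w) * f (x + h • u) := by
    have := (hint (x - (s * h) • w)).comp_add_right (s • w)
    refine this.congr (.of_forall fun u => ?_)
    simp only []
    congr 2
    module
  have hsub : ∫ u, (l1BallIndicator u - l1BallIndicator (u + s • w)) * f (x + h • u) =
      (∫ u, l1BallIndicator u * f (x + h • u)) -
        ∫ u, l1BallIndicator u * f (x - (s * h) • w + h • u) := by
    rw [htrans, ← integral_sub (hint x) hint2]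
    simp only [sub_mul]
  rw [hsub, ← mul_assoc, ← mul_inv, mul_comm h s, ← integral_sub (hint _) (hint _),
    ← integral_sub (hint _) (hint _), ← integral_const_mul]
  refine integral_mono ((hint _).sub (hint _)) (((hint _).sub (hint _)).const_mul _) fun u => ?_
  have h1 := hf.sub_le_inv_mul_sub (x + h • u) w ht ht1
  have e1 : x + h • u - w = x - w + h • u := by abel
  have e2 : x + h • u - (s * h) • w = x - (s * h) • w + h • u := by abel
  rw [e1, e2] at h1
  have := mul_le_mul_of_nonneg_left h1 (l1BallIndicator_nonneg u)
  simp only [← mul_sub]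
  linarith

theorem sub_le_integral_mul_inner_signVec (hd : 0 < d)
    (hC : C ≠ 0) (hC' : C ≠ ⊤) (hν : ν (l1Sphere d)ᶜ = 0)
    (hvol : (volume : Measure (EuclideanSpace ℝ (Fin d))) =
      C • (ν.prod (radialMeasure d)).map fun p => p.2 • p.1)
    {f : EuclideanSpace ℝ (Fin d) → ℝ} {L : ℝ} (hL : 0 ≤ L)
    (hLip : ∀ u v, |f u - f v| ≤ L * ‖u - v‖) (hfc : Continuous f) (hf : ConvexOn ℝ Set.univ f)
    {h : ℝ} (hh : 0 < h) (x w : EuclideanSpace ℝ (Fin d)) :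
    f x - f (x - w) - 2 * (L * h * √(2 / (d + 1))) ≤
      d / h * ∫ θ, f (x + h • θ) * inner ℝ (signVec θ) w ∂ν := by
  have h1 := integral_l1Ball_sub_le hd hC hC' hν hvol hfc hf hh x w
  have h2 := abs_le.1 (abs_integral_l1BallIndicator_mul_sub_le hd hν hvol hfc hL hLip hh x)
  have h3 := abs_le.1 (abs_integral_l1BallIndicator_mul_sub_le hd hν hvol hfc hL hLip hh (x - w))
  have hd' : (0 : ℝ) < d := by exact_mod_cast hd
  have hCp : 0 < C.toReal := ENNReal.toReal_pos hC hC'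
  have hcd : 0 < C.toReal / d := by positivity
  refine le_of_mul_le_mul_left ?_ hcd
  have e : C.toReal / d * (d / h * ∫ θ, f (x + h • θ) * inner ℝ (signVec θ) w ∂ν) =
      h⁻¹ * (C.toReal * ∫ θ, f (x + h • θ) * inner ℝ (signVec θ) w ∂ν) := by
    field_simp
  rw [e]
  linarith [h2.1, h3.2]

end

/-! ### Dual averaging on the Euclidean unit ball. -/

section DualAveraging

variable {E : Type*} [NormedAddCommGroup E] [InnerProductSpace ℝ E]

/-- The nearest-point projection onto the closed unit ball. -/
noncomputable def unitBallProj (y : E) : E := (max 1 ‖y‖)⁻¹ • y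

theorem norm_unitBallProj_le (y : E) : ‖unitBallProj y‖ ≤ 1 := by
  have h : 0 < max 1 ‖y‖ := lt_max_of_lt_left one_pos
  rw [unitBallProj, norm_smul, norm_inv, Real.norm_of_nonneg h.le, inv_mul_le_one₀ h]
  exact le_max_right _ _

@[fun_prop]
theorem continuous_unitBallProj : Continuous (unitBallProj : E → E) := by
  unfold unitBallProj
  refine Continuous.smul (Continuous.inv₀ (by fun_prop) fun y => ?_) continuous_id
  exact (lt_max_of_lt_left one_pos).ne'

theorem inner_sub_unitBallProj_nonpos (y : E) {v : E} (hv : ‖v‖ ≤ 1) :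
    inner ℝ (y - unitBallProj y) (v - unitBallProj y) ≤ 0 := by
  rcases le_or_gt ‖y‖ 1 with h | h
  · have : unitBallProj y = y := by simp [unitBallProj, max_eq_left h]
    simp [this]
  · have h0 : ‖y‖ ≠ 0 := by positivity
    set p := unitBallProj y with hp
    have hp' : p = ‖y‖⁻¹ • y := by rw [hp, unitBallProj, max_eq_right h.le]
    have hn : ‖p‖ = 1 := by rw [hp', norm_smul, norm_inv, norm_norm, inv_mul_cancel₀ h0]
    have hy : y = ‖y‖ • p := by rw [hp', smul_smul, mul_inv_cancel₀ h0, one_smul]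
    have e : y - p = (‖y‖ - 1) • p := by rw [sub_smul, ← hy, one_smul]
    rw [e, real_inner_smul_left, inner_sub_right, real_inner_self_eq_norm_sq, hn]
    have h1 := real_inner_le_norm p v
    rw [hn, one_mul] at h1
    nlinarith

theorem inner_sub_half_norm_sq_eq (y p v : E) :
    inner ℝ y v - 1 / 2 * ‖v‖ ^ 2 =
      inner ℝ y p - 1 / 2 * ‖p‖ ^ 2 + inner ℝ (y - p) (v - p) - 1 / 2 * ‖v - p‖ ^ 2 := by
  rw [norm_sub_sq_real, inner_sub_left, inner_sub_right, inner_sub_right,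
    real_inner_self_eq_norm_sq, real_inner_comm v p]
  ring

theorem inner_sub_half_norm_sq_le (y : E) {v : E} (hv : ‖v‖ ≤ 1) :
    inner ℝ y v - 1 / 2 * ‖v‖ ^ 2 ≤ inner ℝ y (unitBallProj y) - 1 / 2 * ‖unitBallProj y‖ ^ 2
      - 1 / 2 * ‖v - unitBallProj y‖ ^ 2 := by
  rw [inner_sub_half_norm_sq_eq y (unitBallProj y) v]
  linarith [inner_sub_unitBallProj_nonpos y hv]

/-- Strong concavity makes the maximizer unique, so the abstract argmax is an explicit continuous
function of the dual variable. -/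
theorem eq_unitBallProj_of_isMaxOn {η : ℝ} {z x : E} (hx : x ∈ Metric.closedBall 0 1)
    (h : IsMaxOn (fun u => η * inner ℝ z u - 1 / 2 * ‖u‖ ^ 2) (Metric.closedBall 0 1) x) :
    x = unitBallProj (η • z) := by
  have h1 := h (mem_closedBall_zero_iff.2 (norm_unitBallProj_le (η • z)))
  have h2 := inner_sub_half_norm_sq_le (η • z) (mem_closedBall_zero_iff.1 hx)
  simp only [Set.mem_ofPred_eq] at h1
  rw [real_inner_smul_left, real_inner_smul_left] at h2
  have h3 : ‖x - unitBallProj (η • z)‖ ^ 2 ≤ 0 := by linarith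
  have h4 := pow_eq_zero_iff (two_ne_zero) |>.1 (le_antisymm h3 (sq_nonneg _))
  exact sub_eq_zero.1 (norm_eq_zero.1 h4)

/-- The regret bound for dual averaging with the Euclidean regularizer on the unit ball. -/
theorem dualAveraging_regret_le {η : ℝ} {x z g : ℕ → E} (hz0 : z 0 = 0)
    (hx : ∀ t, x t = unitBallProj (η • z t)) (hz : ∀ t, z (t + 1) = z t - g t)
    {u : E} (hu : ‖u‖ ≤ 1) (T : ℕ) :
    η * ∑ t ∈ Finset.range T, inner ℝ (g t) (x t - u) ≤
      1 / 2 + η ^ 2 / 2 * ∑ t ∈ Finset.range T, ‖g t‖ ^ 2 := by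
  -- The maximal value of the regularized objective serves as potential. At each step, the quadratic
  -- term from strong concavity absorbs the movement of `x` by Young's inequality, leaving `η² ‖g‖²
  -- / 2`.
  have hpot : ∀ T, inner ℝ (η • z T) (x T) - 1 / 2 * ‖x T‖ ^ 2 ≤
      -η * ∑ t ∈ Finset.range T, inner ℝ (g t) (x t) +
        η ^ 2 / 2 * ∑ t ∈ Finset.range T, ‖g t‖ ^ 2 := by
    intro T
    induction T with
    | zero =>
      simp [hz0]
    | succ T ih =>
      have h1 := inner_sub_half_norm_sq_le (η • z T)
        (v := x (T + 1)) (by rw [hx]; exact norm_unitBallProj_le _)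
      rw [← hx] at h1
      have h2 : inner ℝ (η • z (T + 1)) (x (T + 1)) =
          inner ℝ (η • z T) (x (T + 1)) - η * inner ℝ (g T) (x T) -
            η * inner ℝ (g T) (x (T + 1) - x T) := by
        rw [hz, smul_sub, inner_sub_left, real_inner_smul_left (g T), inner_sub_right]
        ring
      have h3 : -(η * inner ℝ (g T) (x (T + 1) - x T)) ≤
          1 / 2 * ‖x (T + 1) - x T‖ ^ 2 + η ^ 2 / 2 * ‖g T‖ ^ 2 := by
        have h4 := sq_nonneg ‖η • g T + (x (T + 1) - x T)‖
        rw [norm_add_sq_real, norm_smul, mul_pow, real_inner_smul_left, Real.norm_eq_abs,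
          sq_abs] at h4
        linarith
      rw [Finset.sum_range_succ, Finset.sum_range_succ, h2]
      linarith
  have hsum : ∀ T, z T = -∑ t ∈ Finset.range T, g t := by
    intro T
    induction T with
    | zero => simp [hz0]
    | succ T ih => rw [hz, ih, Finset.sum_range_succ]; abel
  have h1 := inner_sub_half_norm_sq_le (η • z T) hu
  rw [← hx] at h1
  have h2 := hpot T
  have h3 : inner ℝ (η • z T) u = -η * ∑ t ∈ Finset.range T, inner ℝ (g t) u := by
    rw [real_inner_smul_left, hsum, inner_neg_left, sum_inner]
    ring
  have h4 : ∑ t ∈ Finset.range T, inner ℝ (g t) (x t - u) =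
      ∑ t ∈ Finset.range T, inner ℝ (g t) (x t) - ∑ t ∈ Finset.range T, inner ℝ (g t) u := by
    rw [← Finset.sum_sub_distrib]
    exact Finset.sum_congr rfl fun t _ => inner_sub_right _ _ _
  have h5 : ‖u‖ ^ 2 ≤ 1 := pow_le_one₀ (norm_nonneg _) hu
  rw [h3] at h1
  rw [h4, mul_sub]
  nlinarith [sq_nonneg ‖u - x T‖]

end DualAveraging

/-! ### Second moment and bias of the two-point gradient estimate. -/

section GradientEstimate

variable {d : ℕ}

/-- The gradient estimate of `f` at `x` in the absence of noise. -/
noncomputable def l1Gradient (f : EuclideanSpace ℝ (Fin d) → ℝ) (h : ℝ)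
    (x θ : EuclideanSpace ℝ (Fin d)) : EuclideanSpace ℝ (Fin d) :=
  l1GradientEstimate h (f (x + h • θ)) (f (x - h • θ)) θ

theorem l1GradientEstimate_add_same (h a b c : ℝ) (θ : EuclideanSpace ℝ (Fin d)) :
    l1GradientEstimate h (a + c) (b + c) θ = l1GradientEstimate h a b θ := by
  simp [l1GradientEstimate]

theorem norm_l1Gradient_sq (f : EuclideanSpace ℝ (Fin d) → ℝ) (h : ℝ)
    (x θ : EuclideanSpace ℝ (Fin d)) :
    ‖l1Gradient f h x θ‖ ^ 2 =
      (d / (2 * h)) ^ 2 * d * (f (x + h • θ) - f (x - h • θ)) ^ 2 := by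
  rw [l1Gradient, l1GradientEstimate, norm_smul, mul_pow, norm_signVec_sq, Real.norm_eq_abs,
    sq_abs]
  ring

theorem inner_l1Gradient (f : EuclideanSpace ℝ (Fin d) → ℝ) (h : ℝ)
    (x θ w : EuclideanSpace ℝ (Fin d)) :
    inner ℝ (l1Gradient f h x θ) w =
      d / (2 * h) * (f (x + h • θ) * inner ℝ (signVec θ) w) +
      d / (2 * h) * (f (x - h • θ) * inner ℝ (signVec θ) (-w)) := by
  rw [l1Gradient, l1GradientEstimate, real_inner_smul_left, inner_neg_right]
  ring

theorem abs_sub_le_of_l1Norm_eq_one {f : EuclideanSpace ℝ (Fin d) → ℝ} {L : ℝ} (hL : 0 ≤ L)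
    (hLip : ∀ u v, |f u - f v| ≤ L * ‖u - v‖) {h : ℝ} (hh : 0 < h)
    (x : EuclideanSpace ℝ (Fin d)) {θ : EuclideanSpace ℝ (Fin d)} (hθ : l1Norm θ = 1) :
    |f (x + h • θ) - f (x - h • θ)| ≤ L * (2 * h) := by
  refine (hLip _ _).trans ?_
  have e : x + h • θ - (x - h • θ) = (2 * h) • θ := by module
  rw [e, norm_smul, Real.norm_of_nonneg (by positivity)]
  have h1 : ‖θ‖ ≤ 1 := (norm_le_l1Norm θ).trans_eq hθ
  have h2 : 2 * h * ‖θ‖ ≤ 2 * h := mul_le_of_le_one_right (by positivity) h1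
  gcongr

/-- A crude pointwise bound, serving only integrability; the sharper mean-square bound is what
enters the regret. -/
theorem norm_l1Gradient_le {f : EuclideanSpace ℝ (Fin d) → ℝ} {L : ℝ} (hL : 0 ≤ L)
    (hLip : ∀ u v, |f u - f v| ≤ L * ‖u - v‖) {h : ℝ} (hh : 0 < h)
    (x : EuclideanSpace ℝ (Fin d)) {θ : EuclideanSpace ℝ (Fin d)} (hθ : l1Norm θ = 1) :
    ‖l1Gradient f h x θ‖ ≤ d * L * √d := by
  refine le_of_sq_le_sq ?_ (by positivity)
  rw [norm_l1Gradient_sq, mul_pow, mul_pow, Real.sq_sqrt (Nat.cast_nonneg d)]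
  have h1 := pow_le_pow_left₀ (abs_nonneg _) (abs_sub_le_of_l1Norm_eq_one hL hLip hh x hθ) 2
  rw [sq_abs] at h1
  calc (d / (2 * h)) ^ 2 * d * (f (x + h • θ) - f (x - h • θ)) ^ 2
      ≤ (d / (2 * h)) ^ 2 * d * (L * (2 * h)) ^ 2 := by gcongr
    _ = _ := by field_simp

theorem measurable_l1Gradient {f : EuclideanSpace ℝ (Fin d) → ℝ} (hf : Continuous f) (h : ℝ) :
    Measurable fun p : EuclideanSpace ℝ (Fin d) × EuclideanSpace ℝ (Fin d) =>
      l1Gradient f h p.1 p.2 := by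
  unfold l1Gradient l1GradientEstimate
  have h1 : Measurable fun p : EuclideanSpace ℝ (Fin d) × EuclideanSpace ℝ (Fin d) =>
      f (p.1 + h • p.2) := (hf.comp (by fun_prop)).measurable
  have h2 : Measurable fun p : EuclideanSpace ℝ (Fin d) × EuclideanSpace ℝ (Fin d) =>
      f (p.1 - h • p.2) := (hf.comp (by fun_prop)).measurable
  fun_prop

variable {C : ENNReal} {ν : Measure (EuclideanSpace ℝ (Fin d))} [IsProbabilityMeasure ν]

/-- The symmetric difference divided by `2 h L` is odd and `1`-Lipschitz in `θ`, so the spherical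
inequality gives `d³ L² · 72 / d²`. -/
theorem integral_norm_l1Gradient_sq_le (hd : 0 < d) (hν : ν (l1Sphere d)ᶜ = 0)
    (hvol : (volume : Measure (EuclideanSpace ℝ (Fin d))) =
      C • (ν.prod (radialMeasure d)).map fun p => p.2 • p.1)
    {f : EuclideanSpace ℝ (Fin d) → ℝ} {L : ℝ} (hL : 0 < L)
    (hLip : ∀ u v, |f u - f v| ≤ L * ‖u - v‖) {h : ℝ} (hh : 0 < h)
    (x : EuclideanSpace ℝ (Fin d)) :
    ∫ θ, ‖l1Gradient f h x θ‖ ^ 2 ∂ν ≤ 72 * d * L ^ 2 := by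
  set F : EuclideanSpace ℝ (Fin d) → ℝ :=
    fun θ => (2 * h * L)⁻¹ * (f (x + h • θ) - f (x - h • θ)) with hF
  have hFL : LipschitzWith 1 F := by
    refine LipschitzWith.of_dist_le_mul fun θ θ' => ?_
    rw [Real.dist_eq, dist_eq_norm, NNReal.coe_one, one_mul, hF]
    simp only [← mul_sub]
    rw [abs_mul, abs_of_pos (by positivity), inv_mul_le_iff₀ (by positivity)]
    have h1 := hLip (x + h • θ) (x + h • θ')
    have h2 := hLip (x - h • θ') (x - h • θ)
    have e1 : x + h • θ - (x + h • θ') = h • (θ - θ') := by module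
    have e2 : x - h • θ' - (x - h • θ) = h • (θ - θ') := by module
    rw [e1, norm_smul, Real.norm_of_nonneg hh.le] at h1
    rw [e2, norm_smul, Real.norm_of_nonneg hh.le] at h2
    have e3 : f (x + h • θ) - f (x - h • θ) - (f (x + h • θ') - f (x - h • θ')) =
      (f (x + h • θ) - f (x + h • θ')) + (f (x - h • θ') - f (x - h • θ)) := by ring
    rw [e3]
    refine (abs_add_le _ _).trans ?_
    linarith
  have hodd : ∀ θ, F (-θ) = -F θ := fun θ => by
    simp only [hF, smul_neg, sub_neg_eq_add, ← sub_eq_add_neg]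
    ring
  have key := integral_sq_le_of_odd_of_lipschitzWith hd hν hvol hFL hodd
  have hd' : (0 : ℝ) < d := by exact_mod_cast hd
  have e : ∀ θ, ‖l1Gradient f h x θ‖ ^ 2 = d ^ 3 * L ^ 2 * F θ ^ 2 := fun θ => by
    rw [norm_l1Gradient_sq, hF]
    field_simp
  simp only [e, integral_const_mul]
  calc d ^ 3 * L ^ 2 * ∫ θ, F θ ^ 2 ∂ν ≤ d ^ 3 * L ^ 2 * (72 / d ^ 2) := by gcongr
    _ = _ := by field_simp

/-- The two-point estimate averages two one-point estimates: that of `f` at `x`, and that of `y ↦ f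
(-y)` at `-x`. Treating the reflected function avoids any appeal to the symmetry of `ν` or of
`signVec`. -/
theorem sub_le_integral_inner_l1Gradient (hd : 0 < d)
    (hC : C ≠ 0) (hC' : C ≠ ⊤) (hν : ν (l1Sphere d)ᶜ = 0)
    (hvol : (volume : Measure (EuclideanSpace ℝ (Fin d))) =
      C • (ν.prod (radialMeasure d)).map fun p => p.2 • p.1)
    {f : EuclideanSpace ℝ (Fin d) → ℝ} {L : ℝ} (hL : 0 ≤ L)
    (hLip : ∀ u v, |f u - f v| ≤ L * ‖u - v‖) (hfc : Continuous f) (hf : ConvexOn ℝ Set.univ f)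
    {h : ℝ} (hh : 0 < h) (x u : EuclideanSpace ℝ (Fin d)) :
    f x - f u - 2 * (L * h * √(2 / (d + 1))) ≤
      ∫ θ, inner ℝ (l1Gradient f h x θ) (x - u) ∂ν := by
  have h1 := sub_le_integral_mul_inner_signVec hd hC hC' hν hvol hL hLip hfc hf hh x (x - u)
  have hneg : ConvexOn ℝ Set.univ fun y => f (-y) := by
    simpa [Function.comp_def] using
      hf.comp_linearMap (-LinearMap.id : EuclideanSpace ℝ (Fin d) →ₗ[ℝ] EuclideanSpace ℝ (Fin d))
  have h2 := sub_le_integral_mul_inner_signVec hd hC hC' hν hvol (f := fun y => f (-y)) hL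
    (fun u v => (hLip _ _).trans_eq (by rw [neg_sub_neg, norm_sub_rev])) (by fun_prop) hneg hh
    (-x) (-(x - u))
  have e1 : -(-x - -(x - u)) = u := by abel
  have e2 : ∀ θ, -(-x + h • θ) = x - h • θ := fun θ => by abel
  simp only [e1, e2, neg_neg, sub_sub_cancel] at h1 h2
  have hint : ∀ (k : EuclideanSpace ℝ (Fin d) → ℝ) (w : EuclideanSpace ℝ (Fin d)),
      Continuous k → Integrable (fun θ => k θ * inner ℝ (signVec θ) w) ν := by
    intro k w hk
    obtain ⟨M, hM0, hM⟩ := exists_bound_of_l1Norm_le_two hk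
    have := hk.measurable
    refine .of_bound (C := M * l1Norm w) (by fun_prop) ?_
    filter_upwards [show ∀ᵐ θ ∂ν, θ ∈ l1Sphere d from hν] with θ hθ
    have hθ : l1Norm θ = 1 := hθ
    rw [norm_mul, Real.norm_eq_abs, Real.norm_eq_abs]
    have := hM θ (by linarith)
    gcongr
    exact abs_inner_signVec_le θ w
  simp only [inner_l1Gradient]
  rw [integral_add ((hint _ _ (by fun_prop)).const_mul _) ((hint _ _ (by fun_prop)).const_mul _),
    integral_const_mul, integral_const_mul]
  have e3 : (d : ℝ) / (2 * h) = 1 / 2 * (d / h) := by field_simp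
  rw [e3]
  linarith

end GradientEstimate

/-! ### The noise-free run and its dependence on the directions. -/

theorem Measurable.l1Gradient {d : ℕ} {α : Type*} {m : MeasurableSpace α}
    {f : EuclideanSpace ℝ (Fin d) → ℝ} (hf : Continuous f) (h : ℝ)
    {X Y : α → EuclideanSpace ℝ (Fin d)} (hX : Measurable X) (hY : Measurable Y) :
    Measurable fun a => l1Gradient f h (X a) (Y a) := by
  have h1 := hX.prodMk hY
  have h2 := (measurable_l1Gradient hf h).comp h1
  simpa only [Function.comp_def] using h2

section Run

variable {d : ℕ} {Ω : Type*}

/-- The dual variables of noise-free dual averaging with the directions `ζ`. -/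
noncomputable def noiseFreeDual (f : ℕ → EuclideanSpace ℝ (Fin d) → ℝ) (η h : ℝ)
    (ζ : ℕ → Ω → EuclideanSpace ℝ (Fin d)) : ℕ → Ω → EuclideanSpace ℝ (Fin d)
  | 0, _ => 0
  | t + 1, ω => noiseFreeDual f η h ζ t ω -
      l1Gradient (f t) h (unitBallProj (η • noiseFreeDual f η h ζ t ω)) (ζ t ω)

/-- The given `x` and `z` carry no measurability assumption. This replaces them by explicit
measurable functions of the directions. -/
theorem IsL1DualAveragingRun.eq_noiseFreeDual {f : ℕ → EuclideanSpace ℝ (Fin d) → ℝ}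
    {η h : ℝ} {ξ' ξ'' : ℕ → ℝ} {x z : ℕ → EuclideanSpace ℝ (Fin d)}
    {ζ : ℕ → Ω → EuclideanSpace ℝ (Fin d)} {ω : Ω} (hξ : ∀ t, ξ' t = ξ'' t)
    (hrun : IsL1DualAveragingRun (Metric.closedBall 0 1) (fun u => 1 / 2 * ‖u‖ ^ 2) f
      (fun _ => η) (fun _ => h) ξ' ξ'' (fun t => ζ t ω) x z) (t : ℕ) :
    z t = noiseFreeDual f η h ζ t ω ∧ x t = unitBallProj (η • noiseFreeDual f η h ζ t ω) := by
  have hx : ∀ t, x t = unitBallProj (η • z t) := fun t =>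
    eq_unitBallProj_of_isMaxOn (hrun.x_mem t) (hrun.x_argmax t)
  have hz : ∀ t, z t = noiseFreeDual f η h ζ t ω := by
    intro t
    induction t with
    | zero => rw [hrun.z_zero]; rfl
    | succ t ih =>
      rw [hrun.z_succ, hξ t, l1GradientEstimate_add_same, hx t, ih]
      rfl
  exact ⟨hz t, by rw [hx t, hz t]⟩

/-- The σ-algebra uses only indices strictly below `t`; hence the point queried in round `t` is
independent of `ζ t`. -/
theorem measurable_noiseFreeDual {f : ℕ → EuclideanSpace ℝ (Fin d) → ℝ}
    (hf : ∀ t, Continuous (f t)) (η h : ℝ) (ζ : ℕ → Ω → EuclideanSpace ℝ (Fin d)) (t : ℕ) :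
    Measurable[⨆ i ∈ Set.Iio t, MeasurableSpace.comap (ζ i) inferInstance]
      (noiseFreeDual f η h ζ t) := by
  induction t with
  | zero => exact measurable_const
  | succ t ih =>
    set m := ⨆ i ∈ Set.Iio (t + 1), MeasurableSpace.comap (ζ i) inferInstance with hm
    have h1 : Measurable[m] (noiseFreeDual f η h ζ t) :=
      ih.mono (biSup_mono fun i hi => Set.mem_Iio.2 (Nat.lt_succ_of_lt hi)) le_rfl
    have h2 : Measurable[m] (ζ t) :=
      (comap_measurable (ζ t)).mono
        (le_biSup (fun i => MeasurableSpace.comap (ζ i) inferInstance)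
          (Set.mem_Iio.2 (Nat.lt_succ_self t))) le_rfl
    have hproj : Measurable fun z : EuclideanSpace ℝ (Fin d) => unitBallProj (η • z) :=
      (by fun_prop : Continuous _).measurable
    have h3 : Measurable fun p : EuclideanSpace ℝ (Fin d) × EuclideanSpace ℝ (Fin d) =>
        p.1 - l1Gradient (f t) h (unitBallProj (η • p.1)) p.2 :=
      measurable_fst.sub (.l1Gradient (hf t) h (hproj.comp measurable_fst) measurable_snd)
    exact h3.comp (h1.prodMk h2)

theorem indepFun_noiseFreeDual [MeasurableSpace Ω] {P : Measure Ω}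
    {f : ℕ → EuclideanSpace ℝ (Fin d) → ℝ} (hf : ∀ t, Continuous (f t)) (η h : ℝ)
    {ζ : ℕ → Ω → EuclideanSpace ℝ (Fin d)} (hζm : ∀ t, Measurable (ζ t)) (hζi : iIndepFun ζ P)
    (t : ℕ) : IndepFun (noiseFreeDual f η h ζ t) (ζ t) P := by
  have h1 := indep_iSup_of_disjoint (fun i => (hζm i).comap_le) hζi
    (S := Set.Iio t) (T := {t}) (by simp)
  rw [iSup_singleton] at h1
  exact indep_of_indep_of_le_left h1 (measurable_noiseFreeDual hf η h ζ t).comap_le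

theorem measurable_noiseFreeDual' [MeasurableSpace Ω]
    {f : ℕ → EuclideanSpace ℝ (Fin d) → ℝ} (hf : ∀ t, Continuous (f t)) (η h : ℝ)
    {ζ : ℕ → Ω → EuclideanSpace ℝ (Fin d)} (hζm : ∀ t, Measurable (ζ t)) (t : ℕ) :
    Measurable (noiseFreeDual f η h ζ t) :=
  (measurable_noiseFreeDual hf η h ζ t).mono (iSup₂_le fun i _ => (hζm i).comap_le) le_rfl

end Run

/-! ### Expectations over a random query point independent of the direction. -/

theorem integral_indepFun_eq {Ω α β : Type*} [MeasurableSpace Ω] [MeasurableSpace α]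
    [MeasurableSpace β] {P : Measure Ω} [IsProbabilityMeasure P] {X : Ω → α} {Y : Ω → β}
    (hX : Measurable X) (hY : Measurable Y) (h : IndepFun X Y P) {G : α × β → ℝ}
    (hG : Measurable G) (hGi : Integrable (fun ω => G (X ω, Y ω)) P) :
    ∫ ω, G (X ω, Y ω) ∂P = ∫ ω, ∫ b, G (X ω, b) ∂(P.map Y) ∂P ∧
      Integrable (fun ω => ∫ b, G (X ω, b) ∂(P.map Y)) P := by
  have hp := (indepFun_iff_map_prod_eq_prod_map_map hX.aemeasurable hY.aemeasurable).1 h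
  have : IsProbabilityMeasure (P.map X) := Measure.isProbabilityMeasure_map hX.aemeasurable
  have : IsProbabilityMeasure (P.map Y) := Measure.isProbabilityMeasure_map hY.aemeasurable
  have hXY : Measurable fun ω => (X ω, Y ω) := hX.prodMk hY
  have hi : Integrable G ((P.map X).prod (P.map Y)) := by
    rw [← hp]
    exact (integrable_map_measure hG.aestronglyMeasurable hXY.aemeasurable).2 hGi
  have hl := hi.integral_prod_left
  refine ⟨?_, (integrable_map_measure hl.aestronglyMeasurable hX.aemeasurable).1 hl⟩
  rw [← integral_map hX.aemeasurable hl.aestronglyMeasurable, ← integral_prod _ hi, ← hp,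
    integral_map hXY.aemeasurable hG.aestronglyMeasurable]

section Expectation

variable {d : ℕ} {Ω : Type*} [MeasurableSpace Ω] {P : Measure Ω} [IsProbabilityMeasure P]
  {f : EuclideanSpace ℝ (Fin d) → ℝ} {L : ℝ} {h : ℝ} {X ζ : Ω → EuclideanSpace ℝ (Fin d)}

theorem IsUniformOnL1Sphere.ae_l1Norm_eq_one (hd : 0 < d) (hζm : Measurable ζ)
    (hζu : IsUniformOnL1Sphere P ζ) : ∀ᵐ ω ∂P, l1Norm (ζ ω) = 1 := by
  obtain ⟨C, -, -, hν, -⟩ := hζu.exists_volume_eq hd hζm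
  exact ae_of_ae_map hζm.aemeasurable (show ∀ᵐ θ ∂P.map ζ, θ ∈ l1Sphere d from hν)

theorem integrable_norm_l1Gradient_sq (hd : 0 < d) (hζm : Measurable ζ)
    (hζu : IsUniformOnL1Sphere P ζ) (hL : 0 ≤ L) (hLip : ∀ u v, |f u - f v| ≤ L * ‖u - v‖)
    (hfc : Continuous f) (hh : 0 < h) (hX : Measurable X) :
    Integrable (fun ω => ‖l1Gradient f h (X ω) (ζ ω)‖ ^ 2) P := by
  have hg : Measurable fun ω => l1Gradient f h (X ω) (ζ ω) :=
    .l1Gradient hfc h hX hζm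
  refine .of_bound (hg.norm.pow_const 2).aestronglyMeasurable ((d * L * √d) ^ 2) ?_
  filter_upwards [hζu.ae_l1Norm_eq_one hd hζm] with ω hω
  rw [Real.norm_of_nonneg (sq_nonneg _)]
  exact pow_le_pow_left₀ (norm_nonneg _) (norm_l1Gradient_le hL hLip hh _ hω) 2

theorem integrable_inner_l1Gradient (hd : 0 < d) (hζm : Measurable ζ)
    (hζu : IsUniformOnL1Sphere P ζ) (hL : 0 ≤ L) (hLip : ∀ u v, |f u - f v| ≤ L * ‖u - v‖)
    (hfc : Continuous f) (hh : 0 < h) (hX : Measurable X) (hX1 : ∀ ω, ‖X ω‖ ≤ 1)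
    (u : EuclideanSpace ℝ (Fin d)) :
    Integrable (fun ω => inner ℝ (l1Gradient f h (X ω) (ζ ω)) (X ω - u)) P := by
  have hg : Measurable fun ω => l1Gradient f h (X ω) (ζ ω) :=
    .l1Gradient hfc h hX hζm
  refine .of_bound (Measurable.aestronglyMeasurable (by fun_prop))
    (d * L * √d * (1 + ‖u‖)) ?_
  filter_upwards [hζu.ae_l1Norm_eq_one hd hζm] with ω hω
  refine (norm_inner_le_norm _ _).trans ?_
  have h1 := norm_l1Gradient_le hL hLip hh (X ω) hω
  have h2 : ‖X ω - u‖ ≤ 1 + ‖u‖ := (norm_sub_le _ _).trans (by linarith [hX1 ω])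
  gcongr

theorem expectation_norm_l1Gradient_sq_le (hd : 0 < d) (hζm : Measurable ζ)
    (hζu : IsUniformOnL1Sphere P ζ) (hL : 0 < L) (hLip : ∀ u v, |f u - f v| ≤ L * ‖u - v‖)
    (hfc : Continuous f) (hh : 0 < h) (hX : Measurable X) (hind : IndepFun X ζ P) :
    ∫ ω, ‖l1Gradient f h (X ω) (ζ ω)‖ ^ 2 ∂P ≤ 72 * d * L ^ 2 := by
  obtain ⟨C, hC, hC', hν, hvol⟩ := hζu.exists_volume_eq hd hζm
  have : IsProbabilityMeasure (P.map ζ) := Measure.isProbabilityMeasure_map hζm.aemeasurable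
  obtain ⟨h1, h2⟩ := integral_indepFun_eq hX hζm hind
    (G := fun p => ‖l1Gradient f h p.1 p.2‖ ^ 2)
    ((measurable_l1Gradient hfc h).norm.pow_const 2)
    (integrable_norm_l1Gradient_sq hd hζm hζu hL.le hLip hfc hh hX)
  rw [h1]
  refine (integral_mono h2 (integrable_const _) fun ω =>
    integral_norm_l1Gradient_sq_le hd hν hvol hL hLip hh (X ω)).trans_eq ?_
  simp

theorem expectation_sub_le_inner_l1Gradient (hd : 0 < d) (hζm : Measurable ζ)
    (hζu : IsUniformOnL1Sphere P ζ) (hL : 0 ≤ L) (hLip : ∀ u v, |f u - f v| ≤ L * ‖u - v‖)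
    (hfc : Continuous f) (hf : ConvexOn ℝ Set.univ f) (hh : 0 < h) (hX : Measurable X)
    (hX1 : ∀ ω, ‖X ω‖ ≤ 1) (hind : IndepFun X ζ P) (u : EuclideanSpace ℝ (Fin d))
    (hfi : Integrable (fun ω => f (X ω) - f u) P) :
    ∫ ω, (f (X ω) - f u) ∂P ≤
      ∫ ω, inner ℝ (l1Gradient f h (X ω) (ζ ω)) (X ω - u) ∂P
        + 2 * (L * h * √(2 / (d + 1))) := by
  obtain ⟨C, hC, hC', hν, hvol⟩ := hζu.exists_volume_eq hd hζm
  have : IsProbabilityMeasure (P.map ζ) := Measure.isProbabilityMeasure_map hζm.aemeasurable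
  have hg := measurable_l1Gradient hfc h
  obtain ⟨h1, h2⟩ := integral_indepFun_eq hX hζm hind
    (G := fun p => inner ℝ (l1Gradient f h p.1 p.2) (p.1 - u)) (by fun_prop)
    (integrable_inner_l1Gradient hd hζm hζu hL hLip hfc hh hX hX1 u)
  rw [h1]
  have h3 := integral_mono (hfi.sub (integrable_const (2 * (L * h * √(2 / (d + 1)))))) h2
    fun ω => sub_le_integral_inner_l1Gradient hd hC hC' hν hvol hL hLip hfc hf hh (X ω) u
  simp only [Pi.sub_apply] at h3
  rw [integral_sub hfi (integrable_const _)] at h3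
  simp only [integral_const, probReal_univ, smul_eq_mul, one_mul] at h3
  linarith

end Expectation

/-! ### Numerical estimates for the step size and the discretization. -/

section Parameters

theorem cancelingStepSize_two_two (R L : ℝ) (d T : ℕ) :
    cancelingStepSize 2 2 R L d T = R / ((√6 + √12) * L * √((d : ℝ) * T)) := by
  have e : (-1 - 2 / min 2 2 + 2 / 2 : ℝ) = -1 := by norm_num
  rw [cancelingStepSize, e, Real.rpow_neg_one, div_eq_mul_inv (d : ℝ)⁻¹, ← mul_inv,
    Real.sqrt_inv]
  simp only [div_eq_mul_inv, mul_inv]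
  ring

theorem le_bSeq_two_mul_sqrt {d : ℕ} (hd : 3 ≤ d) : 0.9 ≤ bSeq 2 d * √((d : ℝ) + 1) := by
  have hd3 : (3 : ℝ) ≤ d := by exact_mod_cast hd
  have hs : √((d : ℝ) + 1) * √((d : ℝ) + 1) = d + 1 := Real.mul_self_sqrt (by linarith)
  have hs0 : 0 < √((d : ℝ) + 1) := Real.sqrt_pos.2 (by linarith)
  suffices hnum : 0.9 * √((d : ℝ) + 1) ≤ if (2 : ℝ) < Real.log d then 2 * (d : ℝ) ^ (1 / 2 : ℝ)
      else Real.exp 1 * Real.log d by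
    rw [bSeq]
    have h1 : (0 : ℝ) < 1 / (d + 1) := by positivity
    calc (0.9 : ℝ) = 1 / (d + 1) * (0.9 * √((d : ℝ) + 1)) * √((d : ℝ) + 1) := by
          rw [mul_assoc, mul_assoc, hs]; field_simp
      _ ≤ _ := by gcongr
  split_ifs with hlog
  -- Here `2 √d = √(4 d) ≥ √(d + 1)`.
  · rw [← Real.sqrt_eq_rpow]
    have h1 : √((d : ℝ) + 1) ≤ √(4 * d) := Real.sqrt_le_sqrt (by linarith)
    rw [Real.sqrt_mul (by norm_num), show √(4 : ℝ) = 2 by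
      rw [show (4 : ℝ) = 2 ^ 2 by norm_num, Real.sqrt_sq (by norm_num)]] at h1
    linarith
  -- Here `d ≤ e² < 8` gives `√(d + 1) ≤ 3`, while `d ≥ 3 > e` gives `e log d ≥ e > 2.7 = 0.9 · 3`.
  · have he := Real.exp_one_gt_d9
    have he' := Real.exp_one_lt_d9
    have h1 : 1 ≤ Real.log d := by
      rw [Real.le_log_iff_exp_le (by linarith)]
      linarith
    have h2 : (d : ℝ) ≤ 8 := by
      have h3 : (d : ℝ) ≤ Real.exp 2 :=
        (Real.log_le_iff_le_exp (by linarith)).1 (not_lt.1 hlog)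
      rw [show (2 : ℝ) = 1 + 1 by norm_num, Real.exp_add] at h3
      nlinarith
    have h4 : √((d : ℝ) + 1) ≤ 3 := by
      rw [Real.sqrt_le_left (by norm_num)]
      linarith
    nlinarith

theorem bias_le_of_le_cancelingMaxDiscretization {d T : ℕ} (hd : 3 ≤ d) (hT : 1 ≤ T)
    {R h : ℝ} (hR1 : R ≤ 1) (hh : h ≤ cancelingMaxDiscretization 2 2 R d T) :
    2 * h * √(2 / ((d : ℝ) + 1)) * T ≤ 0.3 * √((d : ℝ) * T) := by
  have hb := le_bSeq_two_mul_sqrt hd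
  have hT0 : (0 : ℝ) < T := by exact_mod_cast hT
  have hs0 : 0 < √((d : ℝ) + 1) := Real.sqrt_pos.2 (by positivity)
  have hb0 : 0 < bSeq 2 d := by
    by_contra hc
    have := mul_nonpos_of_nonpos_of_nonneg (not_lt.1 hc) hs0.le
    linarith
  have hT1 : 0 < √(T : ℝ) := Real.sqrt_pos.2 hT0
  have e : (1 / 2 + 1 / min 2 2 - 1 / 2 : ℝ) = 1 / 2 := by norm_num
  rw [cancelingMaxDiscretization, e, ← Real.sqrt_eq_rpow] at hh
  have h1 : h * (bSeq 2 d * √(T : ℝ)) ≤ 0.07 * √(d : ℝ) := by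
    calc h * (bSeq 2 d * √(T : ℝ))
        ≤ 7 * R / (100 * bSeq 2 d * √(T : ℝ)) * √(d : ℝ) * (bSeq 2 d * √(T : ℝ)) := by gcongr
      _ = 0.07 * R * √(d : ℝ) := by field_simp; ring
      _ ≤ 0.07 * 1 * √(d : ℝ) := by gcongr
      _ = _ := by ring
  have hTT : √(T : ℝ) * √(T : ℝ) = T := Real.mul_self_sqrt hT0.le
  have h2 : √(2 : ℝ) ≤ 1.5 := by
    rw [Real.sqrt_le_left (by norm_num)]; norm_num
  rw [Real.sqrt_div (by norm_num), Real.sqrt_mul (Nat.cast_nonneg d)]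
  rcases le_or_gt h 0 with hneg | hpos
  · have : 2 * h * (√2 / √((d : ℝ) + 1)) * T ≤ 0 := by
      have h3 : 0 ≤ √2 / √((d : ℝ) + 1) * T := by positivity
      nlinarith
    have h4 : 0 ≤ 0.3 * (√(d : ℝ) * √(T : ℝ)) := by positivity
    linarith
  · calc 2 * h * (√2 / √((d : ℝ) + 1)) * T
        = 2 * h * √2 * (√(T : ℝ) * √(T : ℝ)) * 0.9 / (0.9 * √((d : ℝ) + 1)) := by
          rw [hTT]; field_simp
      _ ≤ 2 * h * 1.5 * (√(T : ℝ) * √(T : ℝ)) * (bSeq 2 d * √((d : ℝ) + 1)) /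
            (0.9 * √((d : ℝ) + 1)) := by gcongr
      _ = 2 * 1.5 / 0.9 * (h * (bSeq 2 d * √(T : ℝ))) * √(T : ℝ) := by field_simp
      _ ≤ 2 * 1.5 / 0.9 * (0.07 * √(d : ℝ)) * √(T : ℝ) := by gcongr
      _ = 0.07 * 2 * 1.5 / 0.9 * (√(d : ℝ) * √(T : ℝ)) := by ring
      _ ≤ 0.3 * (√(d : ℝ) * √(T : ℝ)) := by
          gcongr
          norm_num

theorem regret_constant_le {R L s : ℝ} (hR : 1 / √2 ≤ R) (hR1 : R ≤ 1) (hL : 0 < L)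
    (hs : 0 < s) :
    (R / ((√6 + √12) * L * s))⁻¹ * (1 / 2) + R / ((√6 + √12) * L * s) / 2 * (72 * L ^ 2 * s ^ 2) ≤
      11 * L * s := by
  have hR0 : 0.7 ≤ R := by
    refine le_trans ?_ hR
    rw [le_div_iff₀ (by positivity)]
    have : √(2 : ℝ) ≤ 1.42 := by
      rw [Real.sqrt_le_left (by norm_num)]; norm_num
    linarith
  set c : ℝ := √6 + √12 with hc
  have h6 : √(6 : ℝ) ≤ 2.45 := by rw [Real.sqrt_le_left (by norm_num)]; norm_num
  have h12 : √(12 : ℝ) ≤ 3.47 := by rw [Real.sqrt_le_left (by norm_num)]; norm_num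
  have h6' : 2.44 ≤ √(6 : ℝ) := Real.le_sqrt_of_sq_le (by norm_num)
  have h12' : 3.46 ≤ √(12 : ℝ) := Real.le_sqrt_of_sq_le (by norm_num)
  have hc0 : 5.9 ≤ c := by rw [hc]; linarith
  have hc1 : c ≤ 5.92 := by rw [hc]; linarith
  have hRp : 0 < R := by linarith
  have hcp : 0 < c := by linarith
  -- With `c = √6 + √12` the two terms are `c / (2 R)` and `36 R / c`, bounded separately over `0.7
  -- ≤ R ≤ 1` by `4.3` and `6.2`.
  have e : (R / (c * L * s))⁻¹ * (1 / 2) + R / (c * L * s) / 2 * (72 * L ^ 2 * s ^ 2) =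
      (c / (2 * R) + 36 * R / c) * (L * s) := by
    field_simp
    ring
  rw [e, mul_assoc]
  have h1 : c / (2 * R) ≤ 4.3 := by
    rw [div_le_iff₀ (by positivity)]; linarith
  have h2 : 36 * R / c ≤ 6.2 := by
    rw [div_le_iff₀ hcp]; linarith
  have hLs : 0 < L * s := by positivity
  gcongr
  linarith

end Parameters

/-! ### The expected regret bound. -/

theorem corollary1 {d : ℕ} (hd : 3 ≤ d) {T : ℕ} (hT : 1 ≤ T)
    {Ω : Type*} [MeasurableSpace Ω] (P : Measure Ω) [IsProbabilityMeasure P]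
    (f : ℕ → EuclideanSpace ℝ (Fin d) → ℝ) (hconv : ∀ t, ConvexOn ℝ Set.univ (f t))
    (L : ℝ) (hL : 0 < L) (hLip : ∀ t u v, |f t u - f t v| ≤ L * ‖u - v‖)
    (ξ' ξ'' : ℕ → Ω → ℝ) (hξ : ∀ t, ∀ᵐ ω ∂P, ξ' t ω = ξ'' t ω)
    (ζ : ℕ → Ω → EuclideanSpace ℝ (Fin d)) (hζm : ∀ t, Measurable (ζ t))
    (hζu : ∀ t, IsUniformOnL1Sphere P (ζ t)) (hζi : iIndepFun ζ P)
    (R : ℝ) (hR : 1 / √2 ≤ R) (hR1 : R ≤ 1)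
    (h : ℝ) (hh : 0 < h) (hhmax : h ≤ cancelingMaxDiscretization 2 2 R d T)
    (x z : ℕ → Ω → EuclideanSpace ℝ (Fin d))
    (hrun : ∀ ω, IsL1DualAveragingRun (Metric.closedBall 0 1) (fun u => 1 / 2 * ‖u‖ ^ 2) f
      (fun _ => cancelingStepSize 2 2 R L d T) (fun _ => h)
      (fun t => ξ' t ω) (fun t => ξ'' t ω) (fun t => ζ t ω) (fun t => x t ω) (fun t => z t ω))
    (u : EuclideanSpace ℝ (Fin d)) (hu : u ∈ Metric.closedBall 0 1) :
    Integrable (fun ω => ∑ t ∈ Finset.range T, (f t (x t ω) - f t u)) P ∧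
      ∫ ω, ∑ t ∈ Finset.range T, (f t (x t ω) - f t u) ∂P ≤ 11.9 * L * √((d : ℝ) * T) := by
  have hd0 : 0 < d := by omega
  have hfc : ∀ t, Continuous (f t) := fun t =>
    (LipschitzWith.of_dist_le_mul (K := L.toNNReal) fun a b => by
      rw [Real.dist_eq, dist_eq_norm, Real.coe_toNNReal _ hL.le]
      exact hLip t a b).continuous
  have hu1 : ‖u‖ ≤ 1 := mem_closedBall_zero_iff.1 hu
  set η := cancelingStepSize 2 2 R L d T with hη
  set Z := noiseFreeDual f η h ζ with hZ
  set X : ℕ → Ω → EuclideanSpace ℝ (Fin d) := fun t ω => unitBallProj (η • Z t ω) with hX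
  set g : ℕ → Ω → EuclideanSpace ℝ (Fin d) :=
    fun t ω => l1Gradient (f t) h (X t ω) (ζ t ω) with hg
  have hXeq : ∀ᵐ ω ∂P, ∀ t, x t ω = X t ω := by
    filter_upwards [ae_all_iff.2 hξ] with ω hω t
    exact ((hrun ω).eq_noiseFreeDual hω t).2
  have hproj : Measurable fun z : EuclideanSpace ℝ (Fin d) => unitBallProj (η • z) :=
    (by fun_prop : Continuous _).measurable
  have hXm : ∀ t, Measurable (X t) := fun t =>
    hproj.comp (measurable_noiseFreeDual' hfc η h hζm t)
  have hXind : ∀ t, IndepFun (X t) (ζ t) P := fun t =>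
    (indepFun_noiseFreeDual hfc η h hζm hζi t).comp hproj measurable_id
  have hX1 : ∀ t ω, ‖X t ω‖ ≤ 1 := fun t ω => norm_unitBallProj_le _
  have hfi : ∀ t, Integrable (fun ω => f t (X t ω) - f t u) P := by
    intro t
    refine .of_bound ((((hfc t).measurable.comp (hXm t)).sub_const _).aestronglyMeasurable)
      (L * 2) (.of_forall fun ω => (hLip t _ _).trans ?_)
    have : ‖X t ω - u‖ ≤ 2 := (norm_sub_le _ _).trans (by linarith [hX1 t ω])
    gcongr
  have hae : (fun ω => ∑ t ∈ Finset.range T, (f t (x t ω) - f t u)) =ᵐ[P]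
      fun ω => ∑ t ∈ Finset.range T, (f t (X t ω) - f t u) := by
    filter_upwards [hXeq] with ω hω
    simp only [hω]
  refine ⟨(integrable_finsetSum _ fun t _ => hfi t).congr hae.symm, ?_⟩
  rw [integral_congr_ae hae, integral_finsetSum _ fun t _ => hfi t]
  have hs : 0 < √((d : ℝ) * T) := Real.sqrt_pos.2 (by
    have : (0 : ℝ) < d := by exact_mod_cast hd0
    have : (0 : ℝ) < T := by exact_mod_cast hT
    positivity)
  have hRp : 0 < R := lt_of_lt_of_le (by positivity) hR
  have hηv : η = R / ((√6 + √12) * L * √((d : ℝ) * T)) := cancelingStepSize_two_two R L d T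
  have hηp : 0 < η := by rw [hηv]; positivity
  have hIi : ∀ t, Integrable (fun ω => inner ℝ (g t ω) (X t ω - u)) P := fun t =>
    integrable_inner_l1Gradient hd0 (hζm t) (hζu t) hL.le (hLip t) (hfc t) hh (hXm t) (hX1 t) u
  have hGi : ∀ t, Integrable (fun ω => ‖g t ω‖ ^ 2) P := fun t =>
    integrable_norm_l1Gradient_sq hd0 (hζm t) (hζu t) hL.le (hLip t) (hfc t) hh (hXm t)
  have hG : ∀ t, ∫ ω, ‖g t ω‖ ^ 2 ∂P ≤ 72 * d * L ^ 2 := fun t =>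
    expectation_norm_l1Gradient_sq_le hd0 (hζm t) (hζu t) hL (hLip t) (hfc t) hh (hXm t) (hXind t)
  have hI : ∀ t, ∫ ω, (f t (X t ω) - f t u) ∂P ≤
      ∫ ω, inner ℝ (g t ω) (X t ω - u) ∂P + 2 * (L * h * √(2 / (d + 1))) := fun t =>
    expectation_sub_le_inner_l1Gradient hd0 (hζm t) (hζu t) hL.le (hLip t) (hfc t) (hconv t) hh
      (hXm t) (hX1 t) (hXind t) u (hfi t)
  have hregret : ∑ t ∈ Finset.range T, ∫ ω, inner ℝ (g t ω) (X t ω - u) ∂P ≤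
      η⁻¹ * (1 / 2) + η / 2 * (T * (72 * d * L ^ 2)) := by
    -- The regret bound holds for every `ω`, since the noise-free recursion is dual averaging by
    -- definition; only the passage from `x` to `X` is almost sure.
    have hpath : ∀ ω, ∑ t ∈ Finset.range T, inner ℝ (g t ω) (X t ω - u) ≤
        η⁻¹ * (1 / 2) + η / 2 * ∑ t ∈ Finset.range T, ‖g t ω‖ ^ 2 := by
      intro ω
      have h1 := dualAveraging_regret_le (η := η) (x := fun t => X t ω) (z := fun t => Z t ω)
        (g := fun t => g t ω) rfl (fun t => rfl) (fun t => rfl) hu1 T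
      rw [← le_inv_mul_iff₀ hηp] at h1
      refine h1.trans_eq ?_
      field_simp
    have hGs := integrable_finsetSum (Finset.range T) fun t _ => hGi t
    rw [← integral_finsetSum _ fun t _ => hIi t]
    refine (integral_mono (integrable_finsetSum _ fun t _ => hIi t)
      ((integrable_const _).add (hGs.const_mul (η / 2))) hpath).trans ?_
    simp only [Pi.add_apply]
    rw [integral_add (integrable_const _) (hGs.const_mul _), integral_const_mul (η / 2),
      integral_finsetSum _ fun t _ => hGi t]
    simp only [integral_const, probReal_univ, smul_eq_mul, one_mul]
    have h2 := Finset.sum_le_sum fun t (_ : t ∈ Finset.range T) => hG t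
    simp only [Finset.sum_const, Finset.card_range, nsmul_eq_mul] at h2
    gcongr
  have hbias := bias_le_of_le_cancelingMaxDiscretization hd hT hR1 hhmax
  have hconst := regret_constant_le hR hR1 hL hs
  rw [← hηv, Real.sq_sqrt (by positivity)] at hconst
  have hsum := Finset.sum_le_sum fun t (_ : t ∈ Finset.range T) => hI t
  rw [Finset.sum_add_distrib] at hsum
  simp only [Finset.sum_const, Finset.card_range, nsmul_eq_mul] at hsum
  have hbias' := mul_le_mul_of_nonneg_left hbias hL.le
  have e1 : η / 2 * (T * (72 * d * L ^ 2)) = η / 2 * (72 * L ^ 2 * (d * T)) := by ring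
  rw [e1] at hregret
  have hLs : 0 < L * √((d : ℝ) * T) := by positivity
  -- Regret contributes `11` and bias `0.3`, within `11.9`.
  linarith
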